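/- Let $m=GM/c^2>0$, $r_h>0$, $c>0$, and let $\mathcal U(r)=1+\sum_{n\ge1}2\kappa_n (m/r)^n$ be a potential with real coefficients $\kappa_n$ (in terms of the post-Newtonian parameter $\gamma$, $\kappa_1=1+\gamma$) whose series converges for all $r>r_h$ and which is positive there. Consider the static, spherically symmetric metric $d\tilde s^2=(dx^0)^2-\mathcal U(r)\,\delta_{ij}dx^idx^j$, $r=|\mathbf x|$, on the region $r>r_h$. It is conformal to the metric $ds^2=\mathcal A(r)(dx^0)^2-\mathcal B^{-1}(r)\delta_{ij}dx^idx^j$ when $\mathcal U=1/(\mathcal A\mathcal B)$, so it has the same light rays. For $0\le\lambda\le1$, replacing $G$ by $\lambda G$ replaces $m$ by $\lambda m$ and $r_h$ by $\lambda r_h$. Let $\mathbf x_A,\mathbf x_B$ be points of Euclidean $\mathbb R^3$, put $r_A=|\mathbf x_A|$, $r_B=|\mathbf x_B|$, $\mathbf n_A=\mathbf x_A/r_A$, $\mathbf n_B=\mathbf x_B/r_B$, $\mu=\mathbf n_A\cdot\mathbf n_B$, and assume $\mathbf n_A\neq\mathbf n_B$ and $|\mathbf x_A+\xi(\mathbf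 x_B-\mathbf x_A)|>r_h$ for $0\le\xi\le1$. Suppose that all pairs $(\mathbf y_A,\mathbf y_B)$ in a neighbourhood of $(\mathbf x_A,\mathbf x_B)$ are joined by quasi-Minkowskian light rays $$x^0=ct_A+\xi|\mathbf y_B-\mathbf y_A|+\sum_{n\ge1}\lambda^nX^0_{(n)}(\mathbf y_A,\mathbf y_B,\xi),\qquad \mathbf x=\mathbf y_A+\xi(\mathbf y_B-\mathbf y_A)+\sum_{n\ge1}\lambda^n\mathbf X_{(n)}(\mathbf y_A,\mathbf y_B,\xi),\qquad 0\le\xi\le1,$$ where $X^0_{(n)}$ vanishes at $\xi=0$, $\mathbf X_{(n)}$ vanishes at $\xi=0$ and at $\xi=1$, and the terms are differentiable in $\xi$. The series and their $\xi$-derivatives converge normally, uniformly in $\xi$ and in these endpoints, with a radius of convergence in $\lambda$ greater than $1$. For every $\lambda\in[0,1]$ the path is an affinely parametrized future-directed null geodesic of the metric with mass parameter $\lambda m$, lying in the region $r>\lambda r_h$. Let $\mathcal T^{(n)}(\mathbf y_A,\mathbf y_B)=X^0_{(n)}(\mathbf y_A,\mathbf y_B,1)/c$ be the term of order $n$ in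 the travel time at the actual value of $G$. Then, near $(\mathbf x_A,\mathbf x_B)$, each $\mathcal T^{(n)}$ ($n\ge1$) is a function $\mathcal T^{(n)}(r_A,r_B,\mu)$ of the two radii and of the cosine of the angle only, and it is differentiable in $\mu$ at the given point. The impact parameter $b=J/E$ of the ray joining $\mathbf x_A$ and $\mathbf x_B$, with $E>0$ and $J\ge0$ its constants of motion (energy and angular momentum), is the same at all points of the ray and has the convergent expansion in powers of $G$ $$b=r_c\Big[1+\sum_{n=1}^\infty\Big(\frac{m}{r_c}\Big)^nq_n\Big],\qquad q_n=-c\Big(\frac{r_c}{m}\Big)^n\frac{\sqrt{1-\mu^2}}{r_c}\,\frac{\partial\mathcal T^{(n)}(r_A,r_B,\mu)}{\partial\mu},$$ where $r_c=\dfrac{r_Ar_B}{|\mathbf x_B-\mathbf x_A|}|\mathbf n_A\times\mathbf n_B|>0$ is the Euclidean distance from the origin to the straight line through $\mathbf x_A$ and $\mathbf x_B$. More generally, for every $\lambda\in[0,1]$ the impact parameter of the ray for the constant $\lambda G$ is $r_c\big[1+\sum_{n\ge1}(\lambda m/r_c)^nq_n\big]$, with the same $q_n$. -/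

import Mathlib

open Set Filter Topology

/-- Triples `(a¹, a², a³)` with their Euclidean scalar product and norm. -/
abbrev Vec3 : Type := EuclideanSpace ℝ (Fin 3)

/-- Events `(x⁰, 𝐱)` in quasi-Cartesian coordinates, `x⁰ = c t`. -/
abbrev Event : Type := ℝ × Vec3

/-- The vector product of two triples. -/
def cross (a b : Vec3) : Vec3 :=
  WithLp.toLp 2 (crossProduct (WithLp.ofLp a) (WithLp.ofLp b))

/-- The unit vector `𝐧 = 𝐱 / |𝐱|`. -/
noncomputable def direction (x : Vec3) : Vec3 := ‖x‖⁻¹ • x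

/-- `μ = 𝐧_A · 𝐧_B`. -/
noncomputable def cosAngle (xA xB : Vec3) : ℝ := inner ℝ (direction xA) (direction xB)

/-- The straight segment `𝐳(ξ) = 𝐱_A + ξ (𝐱_B - 𝐱_A)`. -/
noncomputable def segmentPoint (xA xB : Vec3) (ξ : ℝ) : Vec3 := xA + ξ • (xB - xA)

/-- The Euclidean distance `r_c` between the origin and the straight line through the two points. -/
noncomputable def lineDist (xA xB : Vec3) : ℝ :=
  Metric.infDist (0 : Vec3) (affineSpan ℝ {xA, xB} : Set Vec3)

/-- The potential `𝒰(r) = 1 + ∑_{n ≥ 1} 2 κ_n (m / r)ⁿ`; here `κ_1 = 1 + γ`. -/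
noncomputable def potential (κ : ℕ → ℝ) (m r : ℝ) : ℝ :=
  1 + ∑' n : ℕ, 2 * κ (n + 1) * (m / r) ^ (n + 1)

/-- The metric `(dx⁰)² - 𝒰(|𝐱|) δ_{ij} dxⁱ dxʲ` at the event `p`, as a symmetric bilinear form. -/
noncomputable def opticalMetric (U : ℝ → ℝ) (p v w : Event) : ℝ :=
  v.1 * w.1 - U ‖p.2‖ * inner ℝ v.2 w.2

/-- `γ : [0, 1] → Event`, with tangent vector `γ'`, is an affinely parametrized null geodesic of
the metric `g`.  The geodesic equation is written for the covariant components of the tangent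
vector: `d/dξ (g_{αβ} ẋ^β) = (1/2) (∂_α g_{βδ}) ẋ^β ẋ^δ`, contracted with constant vectors `w`. -/
def IsNullGeodesic (g : Event → Event → Event → ℝ) (γ γ' : ℝ → Event) : Prop :=
  ∀ ξ ∈ Icc (0 : ℝ) 1,
    HasDerivWithinAt γ (γ' ξ) (Icc 0 1) ξ ∧
    g (γ ξ) (γ' ξ) (γ' ξ) = 0 ∧
    ∀ w : Event, HasDerivWithinAt (fun s => g (γ s) (γ' s) w)
      (1 / 2 * fderiv ℝ (fun p => g p (γ' ξ) (γ' ξ)) (γ ξ) w) (Icc 0 1) ξ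

/-- The energy `E = l_0`, the time component of the covariant tangent vector. -/
noncomputable def energy (U : ℝ → ℝ) (p v : Event) : ℝ := opticalMetric U p v (1, 0)

/-- The angular momentum `J = -l_φ = 𝒰(r) r² |dφ/dξ|`, where `φ` is the azimuth in the plane of the
motion, oriented so that `J ≥ 0`; note `r² |dφ/dξ| = |𝐱 × d𝐱/dξ|`. -/
noncomputable def angularMomentum (U : ℝ → ℝ) (p v : Event) : ℝ :=
  U ‖p.2‖ * ‖cross p.2 v.2‖

/-- The impact parameter `b = J / E`, evaluated at an event of the ray with tangent vector `v`. -/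
noncomputable def impactParameter (U : ℝ → ℝ) (p v : Event) : ℝ :=
  angularMomentum U p v / energy U p v

/-- The path with perturbation terms `X0 n`, `X n` (`n ≥ 1`) of order `n` in the gravitational
constant, when that constant is `lam` times its actual value:
`x⁰ = c t_A + ξ |𝐱_B - 𝐱_A| + ∑ lamⁿ X0_n(ξ)`, `𝐱 = 𝐳(ξ) + ∑ lamⁿ 𝐗_n(ξ)`. -/
noncomputable def rayPath (c tA : ℝ) (xA xB : Vec3) (X0 : ℕ → ℝ → ℝ) (X : ℕ → ℝ → Vec3)
    (lam ξ : ℝ) : Event :=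
  (c * tA + ξ * ‖xB - xA‖ + ∑' n : ℕ, lam ^ (n + 1) * X0 (n + 1) ξ,
    segmentPoint xA xB ξ + ∑' n : ℕ, lam ^ (n + 1) • X (n + 1) ξ)

/-- The tangent vector of `rayPath`: the series differentiated with respect to `ξ`. -/
noncomputable def rayTangent (xA xB : Vec3) (X0 : ℕ → ℝ → ℝ) (X : ℕ → ℝ → Vec3)
    (lam ξ : ℝ) : Event :=
  (‖xB - xA‖ + ∑' n : ℕ, lam ^ (n + 1) * derivWithin (X0 (n + 1)) (Icc 0 1) ξ,
    (xB - xA) + ∑' n : ℕ, lam ^ (n + 1) • derivWithin (X (n + 1)) (Icc 0 1) ξ)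

/-- Quasi-Minkowskian light rays `Γ_s(𝐲_A, 𝐲_B)` for all pairs of endpoints in `O`, with
perturbation terms `X0 n yA yB ξ` and `X n yA yB ξ` of order `n ≥ 1`.  The series, and those of
their derivatives in `ξ`, are power series in the gravitational constant that converge normally,
with a radius of convergence greater than the actual value of that constant.
For each value `lam` times the actual one, `0 ≤ lam ≤ 1`, they describe a future-directed null
geodesic of the metric with mass parameter `lam * m`, lying in the region of regularity
`r > lam * r_h` of this metric. -/
structure IsQuasiMinkowskian (κ : ℕ → ℝ) (m rh c tA : ℝ) (O : Set (Vec3 × Vec3))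
    (X0 : ℕ → Vec3 → Vec3 → ℝ → ℝ) (X : ℕ → Vec3 → Vec3 → ℝ → Vec3) : Prop where
  time_zero : ∀ n ≥ 1, ∀ y ∈ O, X0 n y.1 y.2 0 = 0
  pos_zero : ∀ n ≥ 1, ∀ y ∈ O, X n y.1 y.2 0 = 0
  pos_one : ∀ n ≥ 1, ∀ y ∈ O, X n y.1 y.2 1 = 0
  time_diff : ∀ n ≥ 1, ∀ y ∈ O, DifferentiableOn ℝ (X0 n y.1 y.2) (Icc 0 1)
  pos_diff : ∀ n ≥ 1, ∀ y ∈ O, DifferentiableOn ℝ (X n y.1 y.2) (Icc 0 1)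
  normal_conv : ∃ R > (1 : ℝ), ∃ M : ℕ → ℝ, Summable (fun n => M n * R ^ n) ∧
    ∀ n ≥ 1, ∀ y ∈ O, ∀ ξ ∈ Icc (0 : ℝ) 1,
      |X0 n y.1 y.2 ξ| ≤ M n ∧ |derivWithin (X0 n y.1 y.2) (Icc 0 1) ξ| ≤ M n ∧
      ‖X n y.1 y.2 ξ‖ ≤ M n ∧ ‖derivWithin (X n y.1 y.2) (Icc 0 1) ξ‖ ≤ M n
  null_geodesic : ∀ y ∈ O, ∀ lam ∈ Icc (0 : ℝ) 1,
    IsNullGeodesic (opticalMetric (potential κ (lam * m)))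
      (rayPath c tA y.1 y.2 (fun n => X0 n y.1 y.2) (fun n => X n y.1 y.2) lam)
      (rayTangent y.1 y.2 (fun n => X0 n y.1 y.2) (fun n => X n y.1 y.2) lam)
  future : ∀ y ∈ O, ∀ lam ∈ Icc (0 : ℝ) 1, ∀ ξ ∈ Icc (0 : ℝ) 1,
    0 < (rayTangent y.1 y.2 (fun n => X0 n y.1 y.2) (fun n => X n y.1 y.2) lam ξ).1
  confined : ∀ y ∈ O, ∀ lam ∈ Icc (0 : ℝ) 1, ∀ ξ ∈ Icc (0 : ℝ) 1,
    lam * rh <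
      ‖(rayPath c tA y.1 y.2 (fun n => X0 n y.1 y.2) (fun n => X n y.1 y.2) lam ξ).2‖

/-- The term `𝒯⁽ⁿ⁾(𝐱_A, 𝐱_B)` of order `n ≥ 1` of the time transfer function `t_B - t_A`, obtained by
putting `ξ = 1` in the expansion of `x⁰ / c`. -/
noncomputable def timeTerm (c : ℝ) (X0 : ℕ → Vec3 → Vec3 → ℝ → ℝ) (n : ℕ) (xA xB : Vec3) : ℝ :=
  X0 n xA xB 1 / c

/-- `q_n = -c (r_c / m)ⁿ (√(1 - μ²) / r_c) ∂𝒯⁽ⁿ⁾(r_A, r_B, μ) / ∂μ`. -/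
noncomputable def impactCoeff (c m rc : ℝ) (T : ℕ → ℝ → ℝ → ℝ → ℝ) (rA rB μ : ℝ) (n : ℕ) : ℝ :=
  -c * (rc / m) ^ n * (Real.sqrt (1 - μ ^ 2) / rc) * deriv (fun ν => T n rA rB ν) μ

/-!
# The impact parameter as the derivative of the time transfer function

Along a ray, parametrized by `ξ ∈ [0, 1]`, the energy `E = ẋ⁰` is constant, hence equal to
`x⁰(1) - x⁰(0) = |𝐱_B - 𝐱_A| + c ∑ λⁿ 𝒯⁽ⁿ⁾`, and the Lagrangian `U |𝐱̇|² / 2` is constantly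
`E² / 2`. So `E² / 2` is the action of the ray, and its derivative with respect to the end point `𝐱_B` is the
final momentum `𝐩 = U 𝐱̇`.  When `𝐱_B` is rotated about the origin this derivative is the angular
momentum, which gives `E ∂E/∂μ = -J / √(1 - μ²)`, that is `b = J / E = -√(1 - μ²) ∂E/∂μ`.

No regularity of the rays in their end points is assumed.  It is replaced by convexity: for a small
gravitational constant the action is convex on the paths near a straight segment with a given
starting point.  Comparing two rays, and a ray with a tilted copy of another one, gives
`𝐩 · Δ ≤ E'² / 2 - E² / 2 ≤ 𝐩 · Δ + |Δ|²`, where `Δ` is the difference of the final points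
(`IsOpticalRay.inner_momentum_le`, `IsOpticalRay.le_inner_momentum`).  For `Δ = 0` this is the
uniqueness of the energy; applied to the image of a ray under an isometry it shows that the terms
`𝒯⁽ⁿ⁾` depend on the two radii and the angle only (`IsQuasiMinkowskian.energyCoeff_eq`).  For
general `Δ` it is the differentiability of `E²`.

This holds for small `λ > 0` only, and is passed to the coefficients of the power series in `λ` by
letting `λ` tend to `0` (`hasDerivAt_coeff`).  The coefficients of `E²` have derivatives that are
summable beyond `λ = 1`.  Those of `E` could a priori grow faster, as `E` may vanish for some
complex `λ` in the unit disc.  On a circle without zeros and of radius greater than `1`, however, the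
increment of `E` is that of `E²` divided by the sum of the two values of `E`, which stays away from
zero, and Cauchy's estimate shows that they do not (`summable_deriv_of_sq`).
Multiplying the series of `E` by that of `∂E/∂μ` then gives the formula for all `λ ∈ [0, 1]`.  The
sign of the angular momentum is the one of the straight line, because a ray without angular momentum
would be radial (`IsQuasiMinkowskian.inner_cross_pos`).
-/

/-! ### Power series depending on a parameter -/

theorem hasFPowerSeriesOnBall_tsum {𝕜 : Type*} [RCLike 𝕜] {a : ℕ → 𝕜} {R : ℝ} (hR : 0 < R)
    (ha : Summable fun n => ‖a n‖ * R ^ n) :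
    HasFPowerSeriesOnBall (fun z : 𝕜 => ∑' n, a n * z ^ n)
      (FormalMultilinearSeries.ofScalars 𝕜 a) 0 (ENNReal.ofReal R) where
  r_le := by
    refine FormalMultilinearSeries.le_radius_of_summable _ (r := R.toNNReal) ?_
    simpa [FormalMultilinearSeries.ofScalars_norm, hR.le] using ha
  r_pos := by simpa using hR
  hasSum := by
    intro y hy
    have hy' : ‖y‖ < R := by
      rw [Metric.mem_eball, edist_zero_right, ← ofReal_norm,
        ENNReal.ofReal_lt_ofReal_iff hR] at hy
      exact hy
    have hs : Summable fun n => a n * y ^ n := by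
      refine Summable.of_norm_bounded ha fun n => ?_
      rw [norm_mul, norm_pow]
      gcongr
    simpa [FormalMultilinearSeries.ofScalars_apply_eq, mul_comm] using hs.hasSum

/-- Cauchy's estimate for the coefficients of a power series. -/
theorem norm_coeff_mul_pow_le {a : ℕ → ℂ} {R ρ C : ℝ} (hρ : 0 < ρ) (hρR : ρ < R)
    (ha : Summable fun n => ‖a n‖ * R ^ n)
    (hC : ∀ z : ℂ, ‖z‖ = ρ → ‖∑' n, a n * z ^ n‖ ≤ C) (n : ℕ) : ‖a n‖ * ρ ^ n ≤ C := by
  have hR : 0 < R := hρ.trans hρR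
  have hf := hasFPowerSeriesOnBall_tsum hR ha
  have hd : DiffContOnCl ℂ (fun z : ℂ => ∑' n, a n * z ^ n) (Metric.ball 0 ρ) := by
    refine DifferentiableOn.diffContOnCl (hf.differentiableOn.mono ?_)
    rw [closure_ball _ hρ.ne']
    intro z hz
    rw [mem_closedBall_zero_iff] at hz
    rw [Metric.mem_eball, edist_zero_right, ← ofReal_norm,
        ENNReal.ofReal_lt_ofReal_iff hR]
    exact hz.trans_lt hρR
  have h1 := Complex.norm_iteratedDeriv_le_of_forall_mem_sphere_norm_le n hρ hd
    (fun z hz => hC z (by simpa using hz))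
  have h2 := hf.factorial_smul 1 n
  rw [← iteratedDeriv_eq_iteratedFDeriv, FormalMultilinearSeries.ofScalars_apply_eq] at h2
  rw [← h2] at h1
  have hn : (0 : ℝ) < n.factorial := by positivity
  have hp : 0 < ρ ^ n := by positivity
  simp only [one_pow, smul_eq_mul, mul_one, nsmul_eq_mul, norm_mul, Complex.norm_natCast] at h1
  rw [mul_div_assoc] at h1
  have h3 := le_of_mul_le_mul_left h1 hn
  rwa [le_div_iff₀ hp] at h3

/-- A power series with nonzero constant term has no zero on some circle of radius in `(1, R)`,
because its zeros in a smaller closed disc are isolated. -/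
theorem exists_circle_ne_zero {a : ℕ → ℂ} {R : ℝ} (hR : 1 < R)
    (ha : Summable fun n => ‖a n‖ * R ^ n) (h0 : a 0 ≠ 0) :
    ∃ ρ, 1 < ρ ∧ ρ < R ∧ ∀ z : ℂ, ‖z‖ = ρ → ∑' n, a n * z ^ n ≠ 0 := by
  by_contra! hcon
  have hR0 : 0 < R := by linarith
  set f : ℂ → ℂ := fun z : ℂ => ∑' n, a n * z ^ n with hfdef
  have hf : HasFPowerSeriesOnBall f _ 0 _ := hasFPowerSeriesOnBall_tsum hR0 ha
  have hball : Metric.eball (0 : ℂ) (ENNReal.ofReal R) = Metric.ball 0 R := by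
    rw [Metric.eball_ofReal]
  set ρ₁ := (1 + R) / 2
  have h1 : 1 < ρ₁ := by simp only [ρ₁]; linarith
  have h2 : ρ₁ < R := by simp only [ρ₁]; linarith
  set Z : Set ℂ := {z | f z = 0 ∧ ‖z‖ ≤ ρ₁}
  have hZinf : Z.Infinite := by
    intro hfin
    have : (Ioo 1 ρ₁) ⊆ norm '' Z := by
      intro ρ hρ
      obtain ⟨z, hz, hz0⟩ := hcon ρ hρ.1 (hρ.2.trans h2)
      exact ⟨z, ⟨hz0, hz.le.trans hρ.2.le⟩, hz⟩
    exact (Ioo_infinite h1) ((hfin.image norm).subset this)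
  obtain ⟨w, hw, hacc⟩ := hZinf.exists_accPt_of_subset_isCompact
    (isCompact_closedBall (0 : ℂ) ρ₁) (fun z hz => by simpa using hz.2)
  have hwR : w ∈ Metric.ball (0 : ℂ) R := Metric.closedBall_subset_ball h2 hw
  have han : AnalyticOnNhd ℂ f (Metric.ball 0 R) := hball ▸ hf.analyticOnNhd
  have heq := han.eqOn_zero_of_preconnected_of_frequently_eq_zero
    (convex_ball (0 : ℂ) R).isPreconnected hwR
    ((accPt_iff_frequently_nhdsNE.mp hacc).mono fun z hz => hz.1)
  have := heq (Metric.mem_ball_self hR0)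
  apply h0
  have h3 : f 0 = a 0 := by
    simp only [hfdef]
    rw [tsum_eq_single 0]
    · simp
    · intro n hn; simp [hn]
  rw [← h3, this]; rfl

theorem tendstoUniformlyOn_tsum_zero {F : ℕ → ℝ → ℝ} {B : ℕ → ℝ} {ρ : ℝ} (hρ : 0 < ρ)
    (hB : Summable fun n => B n * ρ ^ n) {N : Set ℝ} (hF : ∀ n, ∀ ν ∈ N, |F n ν| ≤ B n) :
    TendstoUniformlyOn (fun (l : ℝ) ν => ∑' n, l ^ n * F n ν) (F 0) (𝓝[>] 0) N := by
  rcases N.eq_empty_or_nonempty with rfl | ⟨ν₀, hν₀⟩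
  · exact tendstoUniformlyOn_empty
  have hB0 : ∀ n, 0 ≤ B n := fun n => (abs_nonneg _).trans (hF n ν₀ hν₀)
  set S := ∑' n, B (n + 1) * ρ ^ n
  have hBs : Summable fun n => B (n + 1) * ρ ^ n := by
    have := ((summable_nat_add_iff (f := fun n => B n * ρ ^ n) 1).mpr hB).mul_right ρ⁻¹
    refine this.congr fun n => ?_
    rw [pow_succ]; field_simp
  have key : ∀ l ∈ Ioo 0 ρ, ∀ ν ∈ N, |∑' n, l ^ n * F n ν - F 0 ν| ≤ l * S := by
    intro l hl ν hν
    have hb : ∀ n, ‖l ^ (n + 1) * F (n + 1) ν‖ ≤ l * (B (n + 1) * ρ ^ n) := by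
      intro n
      rw [Real.norm_eq_abs, abs_mul, abs_of_nonneg (pow_nonneg hl.1.le _), pow_succ]
      calc l ^ n * l * |F (n + 1) ν| ≤ ρ ^ n * l * B (n + 1) := by
            have := hl.1.le
            have := pow_le_pow_left₀ hl.1.le hl.2.le n
            have := hF (n + 1) ν hν
            gcongr
        _ = _ := by ring
    have hs : Summable fun n => l ^ (n + 1) * F (n + 1) ν :=
      Summable.of_norm_bounded (hBs.mul_left l) hb
    have hs' : Summable fun n => l ^ n * F n ν :=
      (summable_nat_add_iff (f := fun n => l ^ n * F n ν) 1).mp hs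
    rw [hs'.tsum_eq_zero_add]
    simp only [pow_zero, one_mul, add_sub_cancel_left]
    rw [← Real.norm_eq_abs, ← tsum_mul_left]
    exact tsum_of_norm_bounded (hBs.mul_left l).hasSum hb
  rw [Metric.tendstoUniformlyOn_iff]
  intro ε hε
  have hlim : Tendsto (fun l : ℝ => l * S) (𝓝[>] 0) (𝓝 0) := by
    have : Tendsto (fun l : ℝ => l * S) (𝓝 0) (𝓝 (0 * S)) := (continuous_mul_const S).tendsto 0
    rw [zero_mul] at this
    exact this.mono_left nhdsWithin_le_nhds
  filter_upwards [hlim.eventually_lt_const hε, Ioo_mem_nhdsGT hρ] with l h1 hl ν hν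
  rw [dist_comm, Real.dist_eq]
  exact (key l hl ν hν).trans_lt h1

/-- The case of the constant coefficient in `hasDerivAt_coeff`: a locally uniform limit. -/
theorem hasDerivAt_coeff_zero {F g : ℕ → ℝ → ℝ} {B : ℕ → ℝ} {ρ : ℝ} (hρ : 0 < ρ)
    (hB : Summable fun n => B n * ρ ^ n) {N : Set ℝ} (hN : IsOpen N)
    (hF : ∀ n, ∀ ν ∈ N, |F n ν| ≤ B n) (hg : ∀ n, ∀ ν ∈ N, |g n ν| ≤ B n)
    (hder : ∀ l ∈ Ioo 0 ρ, ∀ ν ∈ N,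
      HasDerivAt (fun ν => ∑' n, l ^ n * F n ν) (∑' n, l ^ n * g n ν) ν) :
    ∀ ν ∈ N, HasDerivAt (F 0) (g 0 ν) ν := by
  intro ν hν
  refine hasDerivAt_of_tendstoUniformlyOn (l := 𝓝[>] (0 : ℝ)) hN
    (tendstoUniformlyOn_tsum_zero hρ hB hg) ?_
    (fun x hx => (tendstoUniformlyOn_tsum_zero hρ hB hF).tendsto_at hx) hν
  filter_upwards [Ioo_mem_nhdsGT hρ] with l hl x hx using hder l hl x hx

/-- If the sum of a normally convergent power series in `l` is differentiable in a parameter for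
each small `l > 0`, with derivative the sum of another normally convergent power series, then the
same holds coefficient by coefficient. -/
theorem hasDerivAt_coeff {F g : ℕ → ℝ → ℝ} {B : ℕ → ℝ} {ρ : ℝ} (hρ : 0 < ρ)
    (hB : Summable fun n => B n * ρ ^ n) {N : Set ℝ} (hN : IsOpen N)
    (hF : ∀ n, ∀ ν ∈ N, |F n ν| ≤ B n) (hg : ∀ n, ∀ ν ∈ N, |g n ν| ≤ B n)
    (hder : ∀ l ∈ Ioo 0 ρ, ∀ ν ∈ N,
      HasDerivAt (fun ν => ∑' n, l ^ n * F n ν) (∑' n, l ^ n * g n ν) ν) (n : ℕ) :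
    ∀ ν ∈ N, HasDerivAt (F n) (g n ν) ν := by
  induction n generalizing F g B with
  | zero => exact hasDerivAt_coeff_zero hρ hB hN hF hg hder
  | succ n ih =>
    have hzero := hasDerivAt_coeff_zero hρ hB hN hF hg hder
    have hBs : Summable fun n => B (n + 1) * ρ ^ n := by
      have := ((summable_nat_add_iff (f := fun n => B n * ρ ^ n) 1).mpr hB).mul_right ρ⁻¹
      refine this.congr fun n => ?_
      rw [pow_succ]; field_simp
    refine ih (F := fun n => F (n + 1)) (g := fun n => g (n + 1)) hBs
      (fun n => hF (n + 1)) (fun n => hg (n + 1)) ?_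
    intro l hl ν hν
    -- dividing the series minus its constant term by `l` shifts the coefficients
    have shift : ∀ {G : ℕ → ℝ → ℝ}, (∀ n, ∀ ν ∈ N, |G n ν| ≤ B n) → ∀ x ∈ N,
        ∑' n, l ^ n * G (n + 1) x = l⁻¹ * (∑' n, l ^ n * G n x - G 0 x) := by
      intro G hG x hx
      have hs : Summable fun n => l ^ n * G n x := by
        refine Summable.of_norm_bounded hB fun n => ?_
        rw [Real.norm_eq_abs, abs_mul, abs_of_nonneg (pow_nonneg hl.1.le _), mul_comm]
        have := hl.1.le
        have := pow_le_pow_left₀ hl.1.le hl.2.le n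
        have h1 := hG n x hx
        have h2 := (abs_nonneg _).trans h1
        gcongr
      rw [hs.tsum_eq_zero_add]
      simp only [pow_zero, one_mul, add_sub_cancel_left]
      rw [← tsum_mul_left]
      congr 1; ext n
      have := hl.1.ne'
      rw [pow_succ]; field_simp
    rw [shift hg ν hν]
    refine (((hder l hl ν hν).sub (hzero ν hν)).const_mul l⁻¹).congr_of_eventuallyEq ?_
    filter_upwards [hN.mem_nhds hν] with x hx using shift hF x hx

/-- A power series vanishing on `(0, ρ)` has zero coefficients. -/
theorem coeff_eq_zero_of_tsum_eq_zero {a : ℕ → ℝ} {ρ : ℝ} (hρ : 0 < ρ)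
    (ha : Summable fun n => |a n| * ρ ^ n) (h0 : ∀ l ∈ Ioo 0 ρ, ∑' n, l ^ n * a n = 0) (n : ℕ) :
    a n = 0 := by
  have h := hasDerivAt_coeff (F := fun n ν => a n * ν) (g := fun _ _ => 0) hρ ha
    (isOpen_Ioo (a := (-1 : ℝ)) (b := 1)) (fun n ν hν => ?_) (fun n ν _ => ?_)
    (fun l hl ν _ => ?_) n 0 (by norm_num)
  · have h2 := (hasDerivAt_id (0 : ℝ)).const_mul (a n)
    simpa using h2.unique h
  · rw [abs_mul]
    exact mul_le_of_le_one_right (abs_nonneg _) (abs_le.mpr ⟨hν.1.le, hν.2.le⟩)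
  · simp
  · have : (fun ν : ℝ => ∑' n, l ^ n * (a n * ν)) = fun _ => 0 := by
      ext ν
      simp_rw [← mul_assoc]
      rw [tsum_mul_right, h0 l hl, zero_mul]
    rw [this]
    simpa using hasDerivAt_const ν (0 : ℝ)

/-- The product of two absolutely convergent power series is the sum of their Cauchy product. -/
theorem hasSum_cauchyProduct {𝕜 : Type*} [RCLike 𝕜] {a b : ℕ → 𝕜} {z : 𝕜}
    (ha : Summable fun n => ‖a n * z ^ n‖) (hb : Summable fun n => ‖b n * z ^ n‖) :
    HasSum (fun n => (∑ kl ∈ Finset.HasAntidiagonal.antidiagonal n, a kl.1 * b kl.2) * z ^ n)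
      ((∑' n, a n * z ^ n) * ∑' n, b n * z ^ n) := by
  have hcongr : ∀ n, ∑ kl ∈ Finset.HasAntidiagonal.antidiagonal n,
      (a kl.1 * z ^ kl.1) * (b kl.2 * z ^ kl.2) =
      (∑ kl ∈ Finset.HasAntidiagonal.antidiagonal n, a kl.1 * b kl.2) * z ^ n := by
    intro n
    rw [Finset.sum_mul]
    refine Finset.sum_congr rfl fun kl hkl => ?_
    rw [← Finset.HasAntidiagonal.mem_antidiagonal.mp hkl, pow_add]; ring
  rw [tsum_mul_tsum_eq_tsum_sum_antidiagonal_of_summable_norm ha hb, tsum_congr hcongr]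
  exact ((summable_norm_sum_mul_antidiagonal_of_summable_norm ha hb).of_norm.congr hcongr).hasSum

/-- Two power series `a`, `b` that are close on a circle where `a` is bounded below by `δ` differ
there at most by the difference of their squares divided by `δ`; Cauchy's estimate passes this
bound to the coefficients. -/
theorem abs_coeff_sub_le_of_sq {a b G : ℕ → ℝ} {R ρ δ h : ℝ} (hρ : 0 < ρ) (hρR : ρ < R)
    (hδ : 0 < δ) (ha : Summable fun n => ‖(a n : ℂ)‖ * R ^ n)
    (hb : Summable fun n => ‖(b n : ℂ)‖ * R ^ n)
    (hlow : ∀ z : ℂ, ‖z‖ = ρ → δ ≤ ‖∑' n, (a n : ℂ) * z ^ n‖)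
    (hclose : ∑' n, |b n - a n| * ρ ^ n ≤ δ) (hG : Summable fun n => G n * ρ ^ n)
    (hsq : ∀ n, |∑ kl ∈ Finset.HasAntidiagonal.antidiagonal n, b kl.1 * b kl.2 -
      ∑ kl ∈ Finset.HasAntidiagonal.antidiagonal n, a kl.1 * a kl.2| ≤ G n * h) (n : ℕ) :
    |b n - a n| * ρ ^ n ≤ h * ((∑' n, G n * ρ ^ n) / δ) := by
  have hρR' : ∀ n, ρ ^ n ≤ R ^ n := fun n => pow_le_pow_left₀ hρ.le hρR.le n
  have hd : Summable fun n => ‖((b n - a n : ℝ) : ℂ)‖ * R ^ n := by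
    have hR : 0 < R := hρ.trans hρR
    refine Summable.of_nonneg_of_le (fun n => by positivity) (fun n => ?_) (hb.add ha)
    rw [← add_mul]
    push_cast
    have := norm_sub_le (b n : ℂ) (a n : ℂ)
    gcongr
  have hz : ∀ {d : ℕ → ℝ}, (Summable fun n => ‖(d n : ℂ)‖ * R ^ n) → ∀ {z : ℂ}, ‖z‖ = ρ →
      Summable fun n => ‖(d n : ℂ) * z ^ n‖ := by
    intro d hd z hz
    refine Summable.of_nonneg_of_le (fun n => norm_nonneg _) (fun n => ?_) hd
    rw [norm_mul, norm_pow, hz]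
    have := hρR' n
    gcongr
  suffices H : ∀ z : ℂ, ‖z‖ = ρ → ‖∑' n, ((b n - a n : ℝ) : ℂ) * z ^ n‖ ≤
      h * ((∑' n, G n * ρ ^ n) / δ) by
    have := norm_coeff_mul_pow_le hρ hρR hd H n
    rwa [Complex.norm_real, Real.norm_eq_abs] at this
  intro z hzρ
  set ea := ∑' n, (a n : ℂ) * z ^ n with hea
  set eb := ∑' n, (b n : ℂ) * z ^ n with heb
  have hsub : ∑' n, ((b n - a n : ℝ) : ℂ) * z ^ n = eb - ea := by
    rw [hea, heb, ← (hz hb hzρ).of_norm.tsum_sub (hz ha hzρ).of_norm]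
    refine tsum_congr fun n => ?_
    push_cast; ring
  have hsmall : ‖eb - ea‖ ≤ δ := by
    rw [← hsub]
    have heq : ∀ n, ‖((b n - a n : ℝ) : ℂ) * z ^ n‖ = |b n - a n| * ρ ^ n := by
      intro n
      rw [norm_mul, norm_pow, hzρ, Complex.norm_real, Real.norm_eq_abs]
    refine (norm_tsum_le_tsum_norm (hz hd hzρ)).trans ?_
    rwa [tsum_congr heq]
  have hadd : δ ≤ ‖eb + ea‖ := by
    have h1 : (2 : ℂ) * ea = (eb + ea) - (eb - ea) := by ring
    have h2 := norm_sub_le (eb + ea) (eb - ea)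
    rw [← h1, norm_mul, Complex.norm_ofNat] at h2
    have := hlow z hzρ
    linarith
  have hprod : ‖eb - ea‖ * ‖eb + ea‖ ≤ h * ∑' n, G n * ρ ^ n := by
    rw [← norm_mul]
    have h1 : (eb - ea) * (eb + ea) = eb * eb - ea * ea := by ring
    have hsa := hasSum_cauchyProduct (hz ha hzρ) (hz ha hzρ)
    have hsb := hasSum_cauchyProduct (hz hb hzρ) (hz hb hzρ)
    rw [h1, ← (hsb.sub hsa).tsum_eq]
    refine tsum_of_norm_bounded (hG.hasSum.mul_left h) fun n => ?_
    have hcast : (∑ kl ∈ Finset.HasAntidiagonal.antidiagonal n, (b kl.1 : ℂ) * b kl.2) -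
        ∑ kl ∈ Finset.HasAntidiagonal.antidiagonal n, (a kl.1 : ℂ) * a kl.2 =
        ((∑ kl ∈ Finset.HasAntidiagonal.antidiagonal n, b kl.1 * b kl.2 -
          ∑ kl ∈ Finset.HasAntidiagonal.antidiagonal n, a kl.1 * a kl.2 : ℝ) : ℂ) := by
      push_cast; rfl
    rw [← sub_mul, hcast, norm_mul, norm_pow, hzρ, Complex.norm_real, Real.norm_eq_abs]
    have hp : 0 ≤ ρ ^ n := by positivity
    calc _ ≤ G n * h * ρ ^ n := mul_le_mul_of_nonneg_right (hsq n) hp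
      _ = _ := by ring
  rw [hsub, ← mul_div_assoc, le_div_iff₀ hδ]
  exact (mul_le_mul_of_nonneg_left hadd (norm_nonneg _)).trans hprod

/-- A family of power series whose squares have Lipschitz coefficients: the derivatives of its
coefficients are summable.  The increments of the coefficients are estimated on a circle of
radius `> 1` on which the series does not vanish. -/
theorem summable_deriv_of_sq {E : ℕ → ℝ → ℝ} {E' B G : ℕ → ℝ} {R ν₀ : ℝ} (hR : 1 < R)
    (hB : Summable fun n => B n * R ^ n) (hG : Summable fun n => G n * R ^ n) {N : Set ℝ}
    (hN : N ∈ 𝓝 ν₀) (hE : ∀ n, ∀ ν ∈ N, |E n ν| ≤ B n) (hE0 : E 0 ν₀ ≠ 0)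
    (hd : ∀ n, HasDerivAt (E n) (E' n) ν₀)
    (hF : ∀ n, ∀ ν ∈ N, |∑ kl ∈ Finset.HasAntidiagonal.antidiagonal n, E kl.1 ν * E kl.2 ν -
      ∑ kl ∈ Finset.HasAntidiagonal.antidiagonal n, E kl.1 ν₀ * E kl.2 ν₀| ≤ G n * |ν - ν₀|) :
    Summable fun n => |E' n| := by
  have hR0 : 0 < R := by linarith
  have hν₀ : ν₀ ∈ N := mem_of_mem_nhds hN
  have hB0 : ∀ n, 0 ≤ B n := fun n => (abs_nonneg _).trans (hE n ν₀ hν₀)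
  have hs : ∀ ν ∈ N, Summable fun n => ‖(E n ν : ℂ)‖ * R ^ n := by
    intro ν hν
    refine Summable.of_nonneg_of_le (fun n => by positivity) (fun n => ?_) hB
    rw [Complex.norm_real, Real.norm_eq_abs]
    have := hE n ν hν
    gcongr
  obtain ⟨ρ, h1ρ, hρR, hne⟩ := exists_circle_ne_zero hR (hs ν₀ hν₀) (by exact_mod_cast hE0)
  have hρ : 0 < ρ := by linarith
  have hρR' : ∀ n, ρ ^ n ≤ R ^ n := fun n => pow_le_pow_left₀ hρ.le hρR.le n
  set e : ℝ → ℂ → ℂ := fun ν z => ∑' n, (E n ν : ℂ) * z ^ n with he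
  have hGnn : ∀ᶠ ν in 𝓝[≠] ν₀, ∀ n, 0 ≤ G n := by
    filter_upwards [mem_nhdsWithin_of_mem_nhds hN, self_mem_nhdsWithin] with ν hν hne n
    have h := (abs_nonneg _).trans (hF n ν hν)
    exact nonneg_of_mul_nonneg_left h (abs_pos.mpr (sub_ne_zero.mpr hne))
  obtain ⟨-, hG0⟩ := hGnn.exists
  -- the minimum of the modulus on the circle
  have hcont : ContinuousOn (e ν₀) (Metric.sphere 0 ρ) := by
    refine (hasFPowerSeriesOnBall_tsum hR0 (hs ν₀ hν₀)).continuousOn.mono ?_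
    rw [Metric.eball_ofReal]
    exact Metric.sphere_subset_closedBall.trans (Metric.closedBall_subset_ball hρR)
  obtain ⟨w, hw, hmin⟩ := (isCompact_sphere (0 : ℂ) ρ).exists_isMinOn
    (NormedSpace.sphere_nonempty.mpr hρ.le) hcont.norm
  set δ := ‖e ν₀ w‖ with hδ
  have hδ0 : 0 < δ := norm_pos_iff.mpr (hne w (by simpa using hw))
  have hδmin : ∀ z : ℂ, ‖z‖ = ρ → δ ≤ ‖e ν₀ z‖ := fun z hz => hmin (by simpa using hz)
  have hBρ : Summable fun n => 2 * B n * ρ ^ n := by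
    refine Summable.of_nonneg_of_le (fun n => ?_) (fun n => ?_) (hB.mul_left 2)
    · have := hB0 n; positivity
    · rw [mul_assoc]
      have := hB0 n; have := hρR' n
      gcongr
  have hGρ : Summable fun n => G n * ρ ^ n := by
    refine Summable.of_nonneg_of_le (fun n => ?_) (fun n => ?_) hG
    · have := hG0 n; positivity
    · have := hG0 n; have := hρR' n
      gcongr
  have hbd : ∀ ν ∈ N, ∀ n, |E n ν - E n ν₀| * ρ ^ n ≤ 2 * B n * ρ ^ n := by
    intro ν hν n
    have h1 := hE n ν hν
    have h2 := hE n ν₀ hν₀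
    have h3 := abs_sub (E n ν) (E n ν₀)
    have : |E n ν - E n ν₀| ≤ 2 * B n := by linarith
    gcongr
  have hlim : Tendsto (fun ν => ∑' n, |E n ν - E n ν₀| * ρ ^ n) (𝓝 ν₀) (𝓝 0) := by
    have := tendsto_tsum_of_dominated_convergence (𝓕 := 𝓝 ν₀)
      (f := fun ν n => |E n ν - E n ν₀| * ρ ^ n) (g := fun _ => 0) hBρ (fun n => ?_) ?_
    · simpa using this
    · have hc : ContinuousAt (fun ν => |E n ν - E n ν₀| * ρ ^ n) ν₀ :=
        (((hd n).continuousAt.sub continuousAt_const).abs).mul continuousAt_const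
      have := hc.tendsto
      simpa using this
    · filter_upwards [hN] with ν hν n
      rw [Real.norm_eq_abs, abs_of_nonneg (by positivity)]
      exact hbd ν hν n
  set S := ∑' n, G n * ρ ^ n
  have key : ∀ᶠ ν in 𝓝 ν₀, ∀ n, |E n ν - E n ν₀| * ρ ^ n ≤ |ν - ν₀| * (S / δ) := by
    filter_upwards [hN, hlim.eventually_lt_const hδ0] with ν hν hlt n
    exact abs_coeff_sub_le_of_sq hρ hρR hδ0 (hs ν₀ hν₀) (hs ν hν) hδmin hlt.le hGρ
      (fun n => hF n ν hν) n
  have hS0 : 0 ≤ S := tsum_nonneg fun n => by have := hG0 n; positivity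
  have hbound : ∀ n, |E' n| ≤ S / δ * ρ⁻¹ ^ n := by
    intro n
    refine (hd n).le_of_lip' (by positivity) ?_
    filter_upwards [key] with ν hν
    have := hν n
    have hp : 0 < ρ ^ n := by positivity
    rw [Real.norm_eq_abs, Real.norm_eq_abs, inv_pow]
    rw [← le_div_iff₀ hp] at this
    refine this.trans_eq ?_
    field_simp
  refine Summable.of_nonneg_of_le (fun n => abs_nonneg _) hbound ?_
  exact (summable_geometric_of_lt_one (by positivity) (inv_lt_one_of_one_lt₀ h1ρ)).mul_left _

/-- The coefficients of a formal power series with nonzero constant term inherit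
differentiability from the coefficients of its square. -/
theorem differentiableAt_of_sq {E : ℕ → ℝ → ℝ} {ν₀ : ℝ} (h0 : DifferentiableAt ℝ (E 0) ν₀)
    (hE0 : E 0 ν₀ ≠ 0)
    (hF : ∀ n, DifferentiableAt ℝ (fun ν =>
      ∑ kl ∈ Finset.HasAntidiagonal.antidiagonal n, E kl.1 ν * E kl.2 ν) ν₀)
    (n : ℕ) : DifferentiableAt ℝ (E n) ν₀ := by
  induction n using Nat.strong_induction_on with
  | _ n ih =>
    rcases n with _ | n
    · exact h0
    have hsum : ∀ ν, ∑ kl ∈ Finset.HasAntidiagonal.antidiagonal (n + 1), E kl.1 ν * E kl.2 ν =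
        2 * E 0 ν * E (n + 1) ν + ∑ k ∈ Finset.range n, E (k + 1) ν * E (n + 1 - (k + 1)) ν := by
      intro ν
      rw [Finset.Nat.sum_antidiagonal_eq_sum_range_succ (fun k l => E k ν * E l ν),
        Finset.sum_range_succ, Finset.sum_range_succ']
      simp only [Nat.sub_self, Nat.sub_zero]
      ring
    have hmid : DifferentiableAt ℝ
        (fun ν => ∑ k ∈ Finset.range n, E (k + 1) ν * E (n + 1 - (k + 1)) ν) ν₀ := by
      refine DifferentiableAt.fun_sum fun k hk => ?_
      have := Finset.mem_range.mp hk
      exact (ih (k + 1) (by omega)).mul (ih (n + 1 - (k + 1)) (by omega))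
    have hquot := ((hF (n + 1)).sub hmid).div (h0.const_mul 2) (by simpa using hE0)
    refine hquot.congr_of_eventuallyEq ?_
    filter_upwards [h0.continuousAt.eventually_ne hE0] with ν hν
    simp only [Pi.div_apply, Pi.sub_apply, hsum]
    field_simp
    ring

theorem sum_antidiagonal_mul_deriv {E : ℕ → ℝ → ℝ} {E' : ℕ → ℝ} {g ν₀ : ℝ} {n : ℕ}
    (hd : ∀ n, HasDerivAt (E n) (E' n) ν₀)
    (hF : HasDerivAt (fun ν => ∑ kl ∈ Finset.HasAntidiagonal.antidiagonal n, E kl.1 ν * E kl.2 ν)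
      (2 * g) ν₀) :
    ∑ kl ∈ Finset.HasAntidiagonal.antidiagonal n, E kl.1 ν₀ * E' kl.2 = g := by
  have h1 := HasDerivAt.fun_sum (u := Finset.HasAntidiagonal.antidiagonal n)
    (A := fun kl ν => E kl.1 ν * E kl.2 ν) fun kl _ => (hd kl.1).mul (hd kl.2)
  have h2 := h1.unique hF
  rw [Finset.sum_add_distrib] at h2
  have h3 : ∑ kl ∈ Finset.HasAntidiagonal.antidiagonal n, E' kl.1 * E kl.2 ν₀ =
      ∑ kl ∈ Finset.HasAntidiagonal.antidiagonal n, E kl.1 ν₀ * E' kl.2 := by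
    rw [← Finset.Nat.sum_antidiagonal_swap]
    exact Finset.sum_congr rfl fun kl _ => mul_comm _ _
  rw [h3] at h2
  linarith

/-! ### Vectors of Euclidean space and the rotated end point -/

theorem cross_apply_zero (a b : Vec3) : cross a b 0 = a 1 * b 2 - a 2 * b 1 := by
  simp [cross, cross_apply]

theorem cross_apply_one (a b : Vec3) : cross a b 1 = a 2 * b 0 - a 0 * b 2 := by
  simp [cross, cross_apply]

theorem cross_apply_two (a b : Vec3) : cross a b 2 = a 0 * b 1 - a 1 * b 0 := by
  simp [cross, cross_apply]

theorem inner_eq_sum_three (a b : Vec3) : inner ℝ a b = a 0 * b 0 + a 1 * b 1 + a 2 * b 2 := by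
  simp [PiLp.inner_apply, Fin.sum_univ_three]
  ring

theorem cross_smul_left (t : ℝ) (a b : Vec3) : cross (t • a) b = t • cross a b := by
  ext i; fin_cases i <;> simp [cross, cross_apply]

theorem cross_smul_right (t : ℝ) (a b : Vec3) : cross a (t • b) = t • cross a b := by
  ext i; fin_cases i <;> simp [cross, cross_apply]

theorem cross_sub_self (a b : Vec3) : cross b (b - a) = cross a b := by
  ext i
  fin_cases i <;>
  simp [cross_apply_zero, cross_apply_one, cross_apply_two] <;> ring

theorem norm_cross_sq (a b : Vec3) :
    ‖cross a b‖ ^ 2 = ‖a‖ ^ 2 * ‖b‖ ^ 2 - inner ℝ a b ^ 2 := by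
  simp only [← real_inner_self_eq_norm_sq, inner_eq_sum_three, cross_apply_zero, cross_apply_one,
    cross_apply_two]
  ring

theorem inner_cross_rotate (a b c : Vec3) : inner ℝ a (cross b c) = inner ℝ b (cross c a) := by
  simp only [inner_eq_sum_three, cross_apply_zero, cross_apply_one, cross_apply_two]
  ring

theorem inner_cross_self_left (a b : Vec3) : inner ℝ a (cross a b) = 0 := by
  simp only [inner_eq_sum_three, cross_apply_zero, cross_apply_one, cross_apply_two]
  ring

theorem cross_cross_right (a b : Vec3) :
    cross (cross a b) b = inner ℝ a b • b - ‖b‖ ^ 2 • a := by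
  rw [← real_inner_self_eq_norm_sq, inner_eq_sum_three, inner_eq_sum_three]
  ext i
  fin_cases i <;>
  simp [cross_apply_zero, cross_apply_one, cross_apply_two] <;> ring

/-- A vector orthogonal to `a` and `b` is a multiple of their vector product. -/
theorem norm_mul_norm_eq_abs_inner_cross {a b L : Vec3} (ha : inner ℝ a L = 0)
    (hb : inner ℝ b L = 0) : ‖cross a b‖ * ‖L‖ = |inner ℝ (cross a b) L| := by
  have h : cross (cross a b) L = 0 := by
    have h1 : cross (cross a b) L = inner ℝ a L • b - inner ℝ b L • a := by
      rw [inner_eq_sum_three, inner_eq_sum_three]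
      ext i
      fin_cases i <;>
      simp [cross_apply_zero, cross_apply_one, cross_apply_two] <;> ring
    rw [h1, ha, hb]; simp
  have h2 := norm_cross_sq (cross a b) L
  rw [h, norm_zero] at h2
  rw [← abs_of_nonneg (mul_nonneg (norm_nonneg (cross a b)) (norm_nonneg L)),
    ← sq_eq_sq_iff_abs_eq_abs]
  linarith

theorem lineDist_eq {xA xB : Vec3} (hne : xA ≠ xB) :
    lineDist xA xB = ‖cross xA xB‖ / ‖xB - xA‖ := by
  set d := xB - xA with hd
  have hd0 : 0 < ‖d‖ := norm_pos_iff.mpr (sub_ne_zero.mpr hne.symm)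
  have hcross : ‖cross xA xB‖ ^ 2 = ‖xA‖ ^ 2 * ‖d‖ ^ 2 - inner ℝ xA d ^ 2 := by
    rw [norm_cross_sq, hd, norm_sub_sq_real, inner_sub_right, real_inner_self_eq_norm_sq,
      real_inner_comm xA xB]
    ring
  have hpt : ∀ t : ℝ, ‖xA + t • d‖ ^ 2 * ‖d‖ ^ 2 =
      ‖cross xA xB‖ ^ 2 + (inner ℝ xA d + t * ‖d‖ ^ 2) ^ 2 := by
    intro t
    rw [hcross, norm_add_sq_real, inner_smul_right, norm_smul, mul_pow, Real.norm_eq_abs, sq_abs]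
    ring
  have hmem : ∀ p : Vec3, p ∈ affineSpan ℝ {xA, xB} ↔ ∃ t : ℝ, xA + t • d = p := by
    intro p
    rw [mem_affineSpan_pair_iff_exists_lineMap_eq]
    simp only [AffineMap.lineMap_apply, vsub_eq_sub, vadd_eq_add, add_comm, ← hd]
  apply le_antisymm
  · set t := - inner ℝ xA d / ‖d‖ ^ 2
    have h1 : xA + t • d ∈ (affineSpan ℝ {xA, xB} : Set Vec3) := (hmem _).mpr ⟨t, rfl⟩
    refine (Metric.infDist_le_dist_of_mem h1).trans ?_
    rw [dist_zero_left, le_div_iff₀ hd0]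
    refine le_of_sq_le_sq ?_ (norm_nonneg _)
    rw [mul_pow, hpt]
    have : inner ℝ xA d + t * ‖d‖ ^ 2 = 0 := by
      simp only [t]; field_simp; ring
    rw [this]; simp
  · rw [lineDist, Metric.le_infDist ⟨xA, (hmem _).mpr ⟨0, by simp⟩⟩]
    intro p hp
    obtain ⟨t, rfl⟩ := (hmem p).mp hp
    rw [dist_zero_left, div_le_iff₀ hd0]
    refine le_of_sq_le_sq ?_ (by positivity)
    rw [mul_pow, hpt]
    nlinarith [sq_nonneg (inner ℝ xA d + t * ‖d‖ ^ 2)]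

theorem norm_cross_direction (xA xB : Vec3) (hA : xA ≠ 0) (hB : xB ≠ 0) :
    ‖xA‖ * ‖xB‖ * ‖cross (direction xA) (direction xB)‖ = ‖cross xA xB‖ := by
  have := norm_pos_iff.mpr hA
  have := norm_pos_iff.mpr hB
  rw [direction, direction, cross_smul_left, cross_smul_right, norm_smul, norm_smul, norm_inv,
    norm_inv, norm_norm, norm_norm]
  field_simp

theorem cosAngle_mul {xA xB : Vec3} (hA : xA ≠ 0) (hB : xB ≠ 0) :
    ‖xA‖ * ‖xB‖ * cosAngle xA xB = inner ℝ xA xB := by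
  have := norm_pos_iff.mpr hA
  have := norm_pos_iff.mpr hB
  rw [cosAngle, direction, direction, real_inner_smul_left, real_inner_smul_right]
  field_simp

theorem norm_direction {x : Vec3} (h : x ≠ 0) : ‖direction x‖ = 1 := by
  have := norm_pos_iff.mpr h
  rw [direction, norm_smul, norm_inv, norm_norm]; field_simp

theorem norm_smul_direction {x : Vec3} (h : x ≠ 0) : ‖x‖ • direction x = x := by
  have := norm_pos_iff.mpr h
  rw [direction, smul_smul, mul_inv_cancel₀ this.ne', one_smul]

/-- The angle is neither `0` nor `π` when the directions differ and the segment avoids the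
origin. -/
theorem cosAngle_mem_Ioo {xA xB : Vec3} (hdir : direction xA ≠ direction xB)
    (hseg : ∀ ξ ∈ Icc (0 : ℝ) 1, segmentPoint xA xB ξ ≠ 0) : cosAngle xA xB ∈ Ioo (-1) 1 := by
  have hA : xA ≠ 0 := by simpa [segmentPoint] using hseg 0 (by simp)
  have hB : xB ≠ 0 := by simpa [segmentPoint] using hseg 1 (by simp)
  have nA := norm_direction hA
  have nB := norm_direction hB
  have hA' := norm_pos_iff.mpr hA
  have hB' := norm_pos_iff.mpr hB
  have hle := abs_real_inner_le_norm (direction xA) (direction xB)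
  rw [nA, nB, mul_one, abs_le] at hle
  constructor
  · refine lt_of_le_of_ne hle.1 fun h => ?_
    have h1 : direction xA + direction xB = 0 := by
      rw [← norm_eq_zero, ← sq_eq_zero_iff, norm_add_sq_real, nA, nB]
      rw [cosAngle] at h
      rw [← h]; norm_num
    have hpos : 0 < ‖xA‖ + ‖xB‖ := by positivity
    refine hseg (‖xA‖ / (‖xA‖ + ‖xB‖)) ⟨by positivity, ?_⟩ ?_
    · rw [div_le_one hpos]; linarith
    · have hB2 : xB = -(‖xB‖ • direction xA) := by
        rw [eq_neg_of_add_eq_zero_left h1, smul_neg, neg_neg, norm_smul_direction hB]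
      have h2 : segmentPoint xA xB (‖xA‖ / (‖xA‖ + ‖xB‖)) =
          (‖xA‖ - ‖xA‖ / (‖xA‖ + ‖xB‖) * (‖xB‖ + ‖xA‖)) • direction xA := by
        have hA2 := (norm_smul_direction hA).symm
        generalize direction xA = n at *
        generalize ‖xA‖ = a at *
        generalize ‖xB‖ = b at *
        rw [segmentPoint, hB2, hA2]
        module
      rw [h2]
      have : ‖xA‖ - ‖xA‖ / (‖xA‖ + ‖xB‖) * (‖xB‖ + ‖xA‖) = 0 := by field_simp; ring
      rw [this, zero_smul]
  · refine lt_of_le_of_ne hle.2 fun h => hdir ?_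
    rw [← sub_eq_zero, ← norm_eq_zero, ← sq_eq_zero_iff, norm_sub_sq_real, nA, nB]
    rw [cosAngle] at h
    rw [h]; norm_num

/-- Two pairs of vectors with the same norms and the same scalar product are related by a linear
isometry, a product of two reflections. -/
theorem exists_isometry {a b a' b' : Vec3} (ha : ‖a‖ = ‖a'‖) (hb : ‖b‖ = ‖b'‖)
    (hab : inner ℝ a b = inner ℝ a' b') : ∃ R : Vec3 ≃ₗᵢ[ℝ] Vec3, R a = a' ∧ R b = b' := by
  set R₁ := (ℝ ∙ (a - a'))ᗮ.reflection
  have h1 : R₁ a = a' := Submodule.reflection_sub ha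
  set R₂ := (ℝ ∙ (R₁ b - b'))ᗮ.reflection
  have h2 : R₂ (R₁ b) = b' := Submodule.reflection_sub (by rw [R₁.norm_map, hb])
  refine ⟨R₁.trans R₂, ?_, h2⟩
  have h3 : R₂ a' = a' := by
    rw [Submodule.reflection_eq_self_iff, Submodule.mem_orthogonal_singleton_iff_inner_right,
      inner_sub_left, sub_eq_zero, ← h1, R₁.inner_map_map, real_inner_comm, hab, h1,
      real_inner_comm]
  simp [h1, h3]

theorem inner_eq_of_cosAngle_eq {a b : Vec3} (ha : a ≠ 0) (hb : b ≠ 0) {a' b' : Vec3} (ha' : a' ≠ 0)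
    (hb' : b' ≠ 0) (h1 : ‖a‖ = ‖a'‖) (h2 : ‖b‖ = ‖b'‖) (h3 : cosAngle a b = cosAngle a' b') :
    inner ℝ a b = inner ℝ a' b' := by
  rw [← cosAngle_mul ha hb, ← cosAngle_mul ha' hb', h1, h2, h3]

/-- The point at distance `|𝐱_B|` from the origin in the half-plane of `𝐱_A`, `𝐱_B`, whose
direction makes with `𝐱_A` an angle of cosine `ν`. -/
noncomputable def rotatedPoint (xA xB : Vec3) (ν : ℝ) : Vec3 :=
  ‖xB‖ • (ν • direction xA + (√(1 - ν ^ 2) / √(1 - cosAngle xA xB ^ 2)) •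
    (direction xB - cosAngle xA xB • direction xA))

/-- The derivative of `rotatedPoint` with respect to the cosine. -/
noncomputable def rotatedPointDeriv (xA xB : Vec3) (ν : ℝ) : Vec3 :=
  ‖xB‖ • (direction xA + (-ν / √(1 - ν ^ 2) / √(1 - cosAngle xA xB ^ 2)) •
    (direction xB - cosAngle xA xB • direction xA))

theorem one_sub_sq_pos {ν : ℝ} (h : ν ∈ Ioo (-1 : ℝ) 1) : 0 < 1 - ν ^ 2 := by
  nlinarith [h.1, h.2]

theorem rotatedPoint_cosAngle {xA xB : Vec3} (hB : xB ≠ 0)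
    (hμ : cosAngle xA xB ∈ Ioo (-1 : ℝ) 1) : rotatedPoint xA xB (cosAngle xA xB) = xB := by
  have h := Real.sqrt_pos.mpr (one_sub_sq_pos hμ)
  rw [rotatedPoint, div_self h.ne', one_smul, add_sub_cancel, norm_smul_direction hB]

theorem norm_rotatedPoint {xA xB : Vec3} (hA : xA ≠ 0) (hB : xB ≠ 0)
    (hμ : cosAngle xA xB ∈ Ioo (-1 : ℝ) 1) {ν : ℝ} (hν : ν ∈ Ioo (-1 : ℝ) 1) :
    ‖rotatedPoint xA xB ν‖ = ‖xB‖ := by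
  have h := one_sub_sq_pos hμ
  have h' := one_sub_sq_pos hν
  have h1 : ‖ν • direction xA + (√(1 - ν ^ 2) / √(1 - cosAngle xA xB ^ 2)) •
    (direction xB - cosAngle xA xB • direction xA)‖ ^ 2 = 1 := by
    rw [norm_add_sq_real, norm_smul, norm_smul, mul_pow, mul_pow, norm_sub_sq_real,
      real_inner_smul_left, real_inner_smul_right, inner_sub_right, real_inner_smul_right,
      real_inner_self_eq_norm_sq, real_inner_smul_right, norm_smul, norm_direction hA,
      norm_direction hB, real_inner_comm (direction xA) (direction xB), Real.norm_eq_abs, sq_abs,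
      Real.norm_eq_abs, sq_abs, Real.norm_eq_abs, mul_pow, sq_abs, div_pow, Real.sq_sqrt h.le,
      Real.sq_sqrt h'.le, ← cosAngle]
    field_simp
    ring
  have h2 : ‖ν • direction xA + (√(1 - ν ^ 2) / √(1 - cosAngle xA xB ^ 2)) •
    (direction xB - cosAngle xA xB • direction xA)‖ = 1 := by
    exact (pow_eq_one_iff_of_nonneg (norm_nonneg _) two_ne_zero).mp h1
  rw [rotatedPoint, norm_smul, h2, norm_norm, mul_one]

theorem cosAngle_rotatedPoint {xA xB : Vec3} (hA : xA ≠ 0) (hB : xB ≠ 0)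
    (hμ : cosAngle xA xB ∈ Ioo (-1 : ℝ) 1) {ν : ℝ} (hν : ν ∈ Ioo (-1 : ℝ) 1) :
    cosAngle xA (rotatedPoint xA xB ν) = ν := by
  have hn := norm_rotatedPoint hA hB hμ hν
  have hB' := norm_pos_iff.mpr hB
  rw [cosAngle, direction.eq_1 (rotatedPoint xA xB ν), hn, rotatedPoint, smul_smul,
    inv_mul_cancel₀ hB'.ne', one_smul, inner_add_right, real_inner_smul_right,
    real_inner_smul_right, inner_sub_right, real_inner_smul_right, real_inner_self_eq_norm_sq,
    norm_direction hA, ← cosAngle]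
  ring

theorem hasDerivAt_rotatedPoint {xA xB : Vec3} {ν : ℝ} (hν : ν ∈ Ioo (-1 : ℝ) 1) :
    HasDerivAt (rotatedPoint xA xB) (rotatedPointDeriv xA xB ν) ν := by
  have h := one_sub_sq_pos hν
  have h1 : HasDerivAt (fun ν : ℝ => √(1 - ν ^ 2)) (-ν / √(1 - ν ^ 2)) ν := by
    convert ((hasDerivAt_pow 2 ν).const_sub 1).sqrt h.ne' using 1
    have := Real.sqrt_pos.mpr h
    field_simp
    ring
  have h2 := (((hasDerivAt_id ν).smul_const (direction xA)).add ((h1.div_const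
    √(1 - cosAngle xA xB ^ 2)).smul_const
      (direction xB - cosAngle xA xB • direction xA))).const_smul ‖xB‖
  rw [one_smul] at h2
  exact h2

theorem continuousAt_rotatedPointDeriv {xA xB : Vec3} {ν : ℝ} (hν : ν ∈ Ioo (-1 : ℝ) 1) :
    ContinuousAt (rotatedPointDeriv xA xB) ν := by
  have h := Real.sqrt_pos.mpr (one_sub_sq_pos hν)
  have h1 : ContinuousAt (fun ν : ℝ => -ν / √(1 - ν ^ 2)) ν :=
    ContinuousAt.div (by fun_prop) (by fun_prop) h.ne'
  exact ((continuousAt_const.add (((h1.div_const _)).smul continuousAt_const)).const_smul ‖xB‖)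

theorem norm_cross_pos {xA xB : Vec3} (hA : xA ≠ 0) (hB : xB ≠ 0)
    (hμ : cosAngle xA xB ∈ Ioo (-1 : ℝ) 1) : 0 < ‖cross xA xB‖ := by
  have hA' := norm_pos_iff.mpr hA
  have hB' := norm_pos_iff.mpr hB
  have hpos := one_sub_sq_pos hμ
  have h : ‖cross xA xB‖ ^ 2 = ‖xA‖ ^ 2 * ‖xB‖ ^ 2 * (1 - cosAngle xA xB ^ 2) := by
    rw [norm_cross_sq, ← cosAngle_mul hA hB]; ring
  refine norm_pos_iff.mpr fun h0 => ?_
  rw [h0, norm_zero] at h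
  have : 0 < ‖xA‖ ^ 2 * ‖xB‖ ^ 2 * (1 - cosAngle xA xB ^ 2) := by positivity
  linarith

/-- The component of `p` along the derivative of `rotatedPoint` is, up to sign, the component of
`𝐱_B × p` along the normal to the plane. -/
theorem inner_rotatedPointDeriv {xA xB : Vec3} (hA : xA ≠ 0) (hB : xB ≠ 0)
    (hμ : cosAngle xA xB ∈ Ioo (-1 : ℝ) 1) (p : Vec3) :
    √(1 - cosAngle xA xB ^ 2) * inner ℝ p (rotatedPointDeriv xA xB (cosAngle xA xB)) =
      -(inner ℝ (cross xA xB) (cross xB p) / ‖cross xA xB‖) := by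
  have h := one_sub_sq_pos hμ
  have hA' := norm_pos_iff.mpr hA
  have hB' := norm_pos_iff.mpr hB
  have hs := Real.sqrt_pos.mpr h
  have hss := Real.sq_sqrt h.le
  have hcr : ‖cross xA xB‖ = ‖xA‖ * ‖xB‖ * √(1 - cosAngle xA xB ^ 2) := by
    rw [← sq_eq_sq₀ (norm_nonneg _) (by positivity), norm_cross_sq, mul_pow, hss,
      ← cosAngle_mul hA hB]
    ring
  have h1 : inner ℝ (cross xA xB) (cross xB p) = inner ℝ p (cross (cross xA xB) xB) := by
    rw [inner_cross_rotate p]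
  rw [h1, cross_cross_right, ← cosAngle_mul hA hB, hcr, rotatedPointDeriv]
  set μ := cosAngle xA xB
  set s := √(1 - μ ^ 2)
  simp only [direction, inner_sub_right, inner_add_right, real_inner_smul_right]
  field_simp
  rw [hss]
  ring

/-! ### Light rays and their constants of motion -/

/-- A spatial light ray of the metric `(dx⁰)² - U(r) δ_{ij} dxⁱ dxʲ` of energy `E`: the momentum
`U v` satisfies the equation of motion and the tangent vector `v` has `U |v|² = E²`. -/
structure IsOpticalRay (U : ℝ → ℝ) (E : ℝ) (x v : ℝ → Vec3) : Prop where
  hasDeriv : ∀ ξ ∈ Icc (0 : ℝ) 1, HasDerivWithinAt x (v ξ) (Icc 0 1) ξ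
  hasDeriv_momentum : ∀ ξ ∈ Icc (0 : ℝ) 1, HasDerivWithinAt (fun s => U ‖x s‖ • v s)
    ((1 / 2 * (deriv U ‖x ξ‖ / ‖x ξ‖) * ‖v ξ‖ ^ 2) • x ξ) (Icc 0 1) ξ
  null : ∀ ξ ∈ Icc (0 : ℝ) 1, U ‖x ξ‖ * ‖v ξ‖ ^ 2 = E ^ 2

theorem le_of_hasDerivWithinAt_nonneg {f f' : ℝ → ℝ}
    (h : ∀ ξ ∈ Icc (0 : ℝ) 1, HasDerivWithinAt f (f' ξ) (Icc 0 1) ξ)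
    (h0 : ∀ ξ ∈ Icc (0 : ℝ) 1, 0 ≤ f' ξ) : f 0 ≤ f 1 := by
  refine monotoneOn_of_hasDerivWithinAt_nonneg (convex_Icc 0 1)
    (fun ξ hξ => (h ξ hξ).continuousWithinAt) (fun ξ hξ => (h ξ (interior_subset hξ)).mono
      interior_subset) (fun ξ hξ => h0 ξ (interior_subset hξ)) (by simp) (by simp) zero_le_one

theorem eq_of_hasDerivWithinAt_zero {F : Type*} [NormedAddCommGroup F] [NormedSpace ℝ F]
    {f : ℝ → F} (h : ∀ ξ ∈ Icc (0 : ℝ) 1, HasDerivWithinAt f 0 (Icc 0 1) ξ) :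
    ∀ ξ ∈ Icc (0 : ℝ) 1, f ξ = f 0 := by
  refine constant_of_derivWithin_zero (fun ξ hξ => (h ξ hξ).differentiableWithinAt) fun ξ hξ => ?_
  have hξ' := Ico_subset_Icc_self hξ
  exact (h ξ hξ').derivWithin (uniqueDiffOn_Icc zero_lt_one ξ hξ')

theorem hasFDerivAt_norm_inner {x : Vec3} (hx : x ≠ 0) :
    HasFDerivAt (fun y : Vec3 => ‖y‖) (‖x‖⁻¹ • innerSL ℝ x) x := by
  have hn := norm_pos_iff.mpr hx
  have h := (hasStrictFDerivAt_norm_sq x).hasFDerivAt.sqrt (by positivity)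
  simp only [Real.sqrt_sq (norm_nonneg _)] at h
  refine h.congr_fderiv ?_
  ext y
  simp
  field_simp

theorem fderiv_opticalMetric {U : ℝ → ℝ} {q v w : Event} (hq : q.2 ≠ 0)
    (hU : DifferentiableAt ℝ U ‖q.2‖) :
    fderiv ℝ (fun p => opticalMetric U p v v) q w =
      -(deriv U ‖q.2‖ / ‖q.2‖ * inner ℝ q.2 w.2 * ‖v.2‖ ^ 2) := by
  have h1 : HasFDerivAt (fun p : Event => ‖p.2‖)
      ((‖q.2‖⁻¹ • innerSL ℝ q.2).comp (ContinuousLinearMap.snd ℝ ℝ Vec3)) q :=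
    (hasFDerivAt_norm_inner hq).comp q hasFDerivAt_snd
  have h2 := ((hU.hasDerivAt.comp_hasFDerivAt q h1).mul_const
    (inner ℝ v.2 v.2)).const_sub (v.1 * v.1)
  have h3 : HasFDerivAt (fun p => opticalMetric U p v v) _ q := h2
  rw [h3.fderiv]
  simp
  field_simp

theorem isOpticalRay_of_isNullGeodesic {U : ℝ → ℝ} {γ γ' : ℝ → Event}
    (h : IsNullGeodesic (opticalMetric U) γ γ') (hx : ∀ ξ ∈ Icc (0 : ℝ) 1, (γ ξ).2 ≠ 0)
    (hU : ∀ ξ ∈ Icc (0 : ℝ) 1, DifferentiableAt ℝ U ‖(γ ξ).2‖) :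
    IsOpticalRay U (γ' 0).1 (fun ξ => (γ ξ).2) (fun ξ => (γ' ξ).2) ∧
      (∀ ξ ∈ Icc (0 : ℝ) 1, (γ' ξ).1 = (γ' 0).1) ∧ (γ 1).1 = (γ 0).1 + (γ' 0).1 := by
  have hE : ∀ ξ ∈ Icc (0 : ℝ) 1, (γ' ξ).1 = (γ' 0).1 := by
    refine eq_of_hasDerivWithinAt_zero fun ξ hξ => ?_
    have := (h ξ hξ).2.2 (1, 0)
    rw [fderiv_opticalMetric (hx ξ hξ) (hU ξ hξ)] at this
    simpa [opticalMetric] using this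
  have hfst : ∀ ξ ∈ Icc (0 : ℝ) 1, HasDerivWithinAt (fun s => (γ s).1) (γ' ξ).1 (Icc 0 1) ξ :=
    fun ξ hξ => (h ξ hξ).1.fst
  refine ⟨⟨fun ξ hξ => (h ξ hξ).1.snd, fun ξ hξ => ?_, fun ξ hξ => ?_⟩, hE, ?_⟩
  · rw [hasDerivWithinAt_iff_hasFDerivWithinAt, hasFDerivWithinAt_euclidean]
    intro i
    rw [hasFDerivWithinAt_iff_hasDerivWithinAt]
    have := (h ξ hξ).2.2 (0, EuclideanSpace.single i 1)
    rw [fderiv_opticalMetric (hx ξ hξ) (hU ξ hξ)] at this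
    have := this.neg
    refine (this.congr_deriv ?_).congr_of_mem (fun s _ => ?_) hξ
    · simp [EuclideanSpace.inner_single_right]
      ring
    · simp [opticalMetric, EuclideanSpace.inner_single_right]
  · have := (h ξ hξ).2.1
    rw [opticalMetric, hE ξ hξ, real_inner_self_eq_norm_sq] at this
    linarith
  · have := eq_of_hasDerivWithinAt_zero (f := fun s => (γ s).1 - s * (γ' 0).1) (fun ξ hξ => ?_)
      1 (by simp)
    · simp at this; linarith
    · have h1 := (hfst ξ hξ).sub ((hasDerivWithinAt_id ξ (Icc 0 1)).mul_const (γ' 0).1)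
      rw [hE ξ hξ] at h1
      simpa [Pi.sub_def] using h1

namespace IsOpticalRay

variable {U : ℝ → ℝ} {E : ℝ} {x v : ℝ → Vec3}

theorem cross_momentum_eq (h : IsOpticalRay U E x v) : ∀ ξ ∈ Icc (0 : ℝ) 1,
    cross (x ξ) (U ‖x ξ‖ • v ξ) = cross (x 0) (U ‖x 0‖ • v 0) := by
  have hc : ∀ i j, ∀ ξ ∈ Icc (0 : ℝ) 1,
      x ξ i * (U ‖x ξ‖ • v ξ) j - x ξ j * (U ‖x ξ‖ • v ξ) i =
      x 0 i * (U ‖x 0‖ • v 0) j - x 0 j * (U ‖x 0‖ • v 0) i := by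
    intro i j
    refine eq_of_hasDerivWithinAt_zero
      (f := fun ξ => x ξ i * (U ‖x ξ‖ • v ξ) j - x ξ j * (U ‖x ξ‖ • v ξ) i) fun ξ hξ => ?_
    have hx : ∀ i, HasDerivWithinAt (fun s => x s i) (v ξ i) (Icc 0 1) ξ := fun i =>
      ((EuclideanSpace.proj (𝕜 := ℝ) i).hasFDerivAt.comp_hasDerivWithinAt ξ (h.hasDeriv ξ hξ))
    have hp : ∀ i, HasDerivWithinAt (fun s => (U ‖x s‖ • v s) i)
        (((1 / 2 * (deriv U ‖x ξ‖ / ‖x ξ‖) * ‖v ξ‖ ^ 2) • x ξ) i) (Icc 0 1) ξ := fun i =>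
      ((EuclideanSpace.proj (𝕜 := ℝ) i).hasFDerivAt.comp_hasDerivWithinAt ξ
        (h.hasDeriv_momentum ξ hξ))
    refine (((hx i).mul (hp j)).sub ((hx j).mul (hp i))).congr_deriv ?_
    simp
    ring
  intro ξ hξ
  ext k
  fin_cases k
  · exact (cross_apply_zero _ _).trans ((hc 1 2 ξ hξ).trans (cross_apply_zero _ _).symm)
  · exact (cross_apply_one _ _).trans ((hc 2 0 ξ hξ).trans (cross_apply_one _ _).symm)
  · exact (cross_apply_two _ _).trans ((hc 0 1 ξ hξ).trans (cross_apply_two _ _).symm)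

/-- A ray without angular momentum is radial. -/
theorem direction_eq_of_cross_eq_zero (h : IsOpticalRay U E x v) (hE : E ≠ 0)
    (hx : ∀ ξ ∈ Icc (0 : ℝ) 1, x ξ ≠ 0) (h0 : cross (x 1) (U ‖x 1‖ • v 1) = 0) :
    direction (x 0) = direction (x 1) := by
  refine (eq_of_hasDerivWithinAt_zero (f := fun s => direction (x s)) (fun ξ hξ => ?_) 1
    (by simp)).symm
  have hn := norm_pos_iff.mpr (hx ξ hξ)
  have hU : U ‖x ξ‖ ≠ 0 := by
    intro hU
    have := h.null ξ hξ
    rw [hU, zero_mul] at this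
    exact hE (pow_eq_zero_iff two_ne_zero |>.mp this.symm)
  have hc : cross (x ξ) (v ξ) = 0 := by
    have h1 : cross (x ξ) (U ‖x ξ‖ • v ξ) = 0 := by
      rw [h.cross_momentum_eq ξ hξ, ← h.cross_momentum_eq 1 (by simp), h0]
    rw [cross_smul_right] at h1
    exact (smul_eq_zero.mp h1).resolve_left hU
  have hpar : inner ℝ (x ξ) (v ξ) • x ξ = ‖x ξ‖ ^ 2 • v ξ := by
    have h2 : cross (cross (v ξ) (x ξ)) (x ξ) = 0 := by
      have : cross (v ξ) (x ξ) = 0 := by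
        rw [← norm_eq_zero, ← sq_eq_zero_iff, norm_cross_sq, real_inner_comm, mul_comm,
          ← norm_cross_sq, hc]; simp
      rw [this]
      ext i; fin_cases i <;> simp [cross]
    rw [cross_cross_right, sub_eq_zero, real_inner_comm] at h2
    exact h2
  have hnorm := (hasFDerivAt_norm_inner (hx ξ hξ)).comp_hasDerivWithinAt ξ (h.hasDeriv ξ hξ)
  refine ((hnorm.inv hn.ne').smul (h.hasDeriv ξ hξ)).congr_deriv ?_
  simp only [Function.comp, smul_apply, innerSL_apply_apply, smul_eq_mul]
  have h3 : (-(‖x ξ‖⁻¹ * inner ℝ (x ξ) (v ξ)) / ‖x ξ‖ ^ 2) • x ξ =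
      -(‖x ξ‖⁻¹ / ‖x ξ‖ ^ 2) • (inner ℝ (x ξ) (v ξ) • x ξ) := by
    rw [smul_smul]; congr 1; ring
  rw [h3, hpar, smul_smul]
  have h4 : -(‖x ξ‖⁻¹ / ‖x ξ‖ ^ 2) * ‖x ξ‖ ^ 2 = -‖x ξ‖⁻¹ := by field_simp
  simp [h4]

theorem map_isometry (h : IsOpticalRay U E x v) (R : Vec3 ≃ₗᵢ[ℝ] Vec3) :
    IsOpticalRay U E (fun ξ => R (x ξ)) (fun ξ => R (v ξ)) where
  hasDeriv ξ hξ := R.toContinuousLinearEquiv.toContinuousLinearMap.hasFDerivAt.comp_hasDerivWithinAt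
    ξ (h.hasDeriv ξ hξ)
  hasDeriv_momentum ξ hξ := by
    have := R.toContinuousLinearEquiv.toContinuousLinearMap.hasFDerivAt.comp_hasDerivWithinAt
      ξ (h.hasDeriv_momentum ξ hξ)
    simpa [Function.comp_def] using this
  null ξ hξ := by simpa using h.null ξ hξ

end IsOpticalRay

/-! ### Convexity of the action in a nearly flat metric -/

/-- The index `U` differs from `1` by at most `ε`, together with its first derivative and its second
order increments as a function of position, at distance at least `r₁` from the origin. -/
structure NearlyFlat (U : ℝ → ℝ) (ε r₁ : ℝ) : Prop where
  sub_one : ∀ r ≥ r₁, |U r - 1| ≤ ε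
  deriv_le : ∀ r ≥ r₁, |deriv U r| ≤ ε
  taylor : ∀ x y : Vec3, r₁ ≤ ‖x‖ → r₁ ≤ ‖y‖ →
    |U ‖y‖ - U ‖x‖ - deriv U ‖x‖ / ‖x‖ * inner ℝ x (y - x)| ≤ ε * ‖y - x‖ ^ 2

/-- The second order increment of the Lagrangian `U |v|² / 2` between `(x, v)` and `(w, u)`. -/
noncomputable def lagrangianExcess (U : ℝ → ℝ) (x v w u : Vec3) : ℝ :=
  1 / 2 * (U ‖w‖ * ‖u‖ ^ 2) - 1 / 2 * (U ‖x‖ * ‖v‖ ^ 2) -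
    (inner ℝ ((1 / 2 * (deriv U ‖x‖ / ‖x‖) * ‖v‖ ^ 2) • x) (w - x) +
      inner ℝ (U ‖x‖ • v) (u - v))

theorem NearlyFlat.abs_lagrangianExcess_sub_le {U : ℝ → ℝ} {ε r₁ S : ℝ} (hU : NearlyFlat U ε r₁)
    (hr : 0 < r₁) {x v w u : Vec3} (hx : r₁ ≤ ‖x‖) (hw : r₁ ≤ ‖w‖) (hv : ‖v‖ ≤ S)
    (hu : ‖u‖ ≤ S) :
    |lagrangianExcess U x v w u - 1 / 2 * ‖u - v‖ ^ 2| ≤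
      ε * (1 + S) ^ 2 * (‖w - x‖ ^ 2 + ‖u - v‖ ^ 2) := by
  have hS : 0 ≤ S := (norm_nonneg v).trans hv
  have hε : 0 ≤ ε := (abs_nonneg _).trans (hU.sub_one r₁ le_rfl)
  have hxp : 0 < ‖x‖ := hr.trans_le hx
  set a := U ‖w‖ - U ‖x‖ - deriv U ‖x‖ / ‖x‖ * inner ℝ x (w - x) with ha
  set b := deriv U ‖x‖ / ‖x‖ * inner ℝ x (w - x) with hb
  set c := U ‖x‖ - 1 with hc
  set δ := ‖w - x‖
  set η := ‖u - v‖ with hη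
  have hδ : 0 ≤ δ := norm_nonneg _
  have hη0 : 0 ≤ η := norm_nonneg _
  have ha' : |a| ≤ ε * δ ^ 2 := hU.taylor x w hx hw
  have hb' : |b| ≤ ε * δ := by
    rw [hb, abs_mul, abs_div, abs_of_pos hxp]
    calc |deriv U ‖x‖| / ‖x‖ * |inner ℝ x (w - x)| ≤ |deriv U ‖x‖| / ‖x‖ * (‖x‖ * δ) := by
          gcongr; exact abs_real_inner_le_norm _ _
      _ = |deriv U ‖x‖| * δ := by field_simp
      _ ≤ ε * δ := by gcongr; exact hU.deriv_le _ hx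
  have hc' : |c| ≤ ε := hU.sub_one _ hx
  have hvu : |‖u‖ ^ 2 - ‖v‖ ^ 2| ≤ 2 * S * η := by
    have h1 : |‖u‖ - ‖v‖| ≤ η := abs_norm_sub_norm_le u v
    have h2 : ‖u‖ ^ 2 - ‖v‖ ^ 2 = (‖u‖ + ‖v‖) * (‖u‖ - ‖v‖) := by ring
    rw [h2, abs_mul, abs_of_nonneg (by positivity)]
    have : ‖u‖ + ‖v‖ ≤ 2 * S := by linarith
    gcongr
  have hkey : lagrangianExcess U x v w u - 1 / 2 * η ^ 2 =
      1 / 2 * a * ‖u‖ ^ 2 + 1 / 2 * b * (‖u‖ ^ 2 - ‖v‖ ^ 2) + 1 / 2 * c * η ^ 2 := by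
    have h1 : η ^ 2 = ‖u‖ ^ 2 - 2 * inner ℝ v u + ‖v‖ ^ 2 := by
      rw [hη, norm_sub_sq_real, real_inner_comm]
    have hin : inner ℝ ((1 / 2 * (deriv U ‖x‖ / ‖x‖) * ‖v‖ ^ 2) • x) (w - x) =
        1 / 2 * ‖v‖ ^ 2 * b := by
      rw [real_inner_smul_left, hb]; ring
    rw [lagrangianExcess, hin, real_inner_smul_left, inner_sub_right,
      real_inner_self_eq_norm_sq, h1]
    have h2 : U ‖w‖ = a + b + U ‖x‖ := by rw [ha]; ring
    have h3 : U ‖x‖ = c + 1 := by rw [hc]; ring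
    rw [h2, h3]
    ring
  rw [hkey]
  have t1 : |1 / 2 * a * ‖u‖ ^ 2| ≤ 1 / 2 * (ε * δ ^ 2) * S ^ 2 := by
    rw [abs_mul, abs_mul, abs_of_nonneg (by positivity : (0 : ℝ) ≤ ‖u‖ ^ 2),
      abs_of_pos (by norm_num : (0 : ℝ) < 1 / 2)]
    gcongr
  have t2 : |1 / 2 * b * (‖u‖ ^ 2 - ‖v‖ ^ 2)| ≤ 1 / 2 * (ε * δ) * (2 * S * η) := by
    rw [abs_mul, abs_mul, abs_of_pos (by norm_num : (0 : ℝ) < 1 / 2)]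
    gcongr
  have t3 : |1 / 2 * c * η ^ 2| ≤ 1 / 2 * ε * η ^ 2 := by
    rw [abs_mul, abs_mul, abs_of_nonneg (by positivity : (0 : ℝ) ≤ η ^ 2),
      abs_of_pos (by norm_num : (0 : ℝ) < 1 / 2)]
    gcongr
  have t4 := abs_add_three (1 / 2 * a * ‖u‖ ^ 2) (1 / 2 * b * (‖u‖ ^ 2 - ‖v‖ ^ 2))
    (1 / 2 * c * η ^ 2)
  have t5 : 1 / 2 * (ε * δ ^ 2) * S ^ 2 + 1 / 2 * (ε * δ) * (2 * S * η) + 1 / 2 * ε * η ^ 2 ≤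
      ε * (1 + S) ^ 2 * (δ ^ 2 + η ^ 2) := by
    have e1 : 1 / 2 * δ ^ 2 * S ^ 2 + δ * (S * η) + 1 / 2 * η ^ 2 ≤
        (1 + S) ^ 2 * (δ ^ 2 + η ^ 2) := by
      have := mul_nonneg hS (sq_nonneg (δ - η))
      have := mul_nonneg hS (sq_nonneg δ)
      have := mul_nonneg hS (sq_nonneg η)
      have := mul_nonneg (sq_nonneg S) (sq_nonneg δ)
      have := mul_nonneg (sq_nonneg S) (sq_nonneg η)
      nlinarith [sq_nonneg δ, sq_nonneg η]
    nlinarith [mul_le_mul_of_nonneg_left e1 hε]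
  linarith

/-- The second order increment of the Lagrangian between two paths `x`, `w` is at least the
derivative of `2 K (2 - ξ) |w - x|²` along them.  The weight `2 - ξ` supplies the Poincaré
inequality for paths that agree at `ξ = 0`. -/
theorem NearlyFlat.le_lagrangianExcess {ε r₁ S K : ℝ} (hU : NearlyFlat U ε r₁)
    (hr : 0 < r₁) (hK : K = ε * (1 + S) ^ 2) (hK' : 34 * K ≤ 1) {ξ : ℝ} (hξ : ξ ∈ Icc (0 : ℝ) 1)
    {x v w u : Vec3} (hx : r₁ ≤ ‖x‖) (hw : r₁ ≤ ‖w‖) (hv : ‖v‖ ≤ S) (hu : ‖u‖ ≤ S) :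
    2 * K * (-‖w - x‖ ^ 2 + (2 - ξ) * (2 * inner ℝ (w - x) (u - v))) ≤
      lagrangianExcess U x v w u := by
  have hε : 0 ≤ ε := (abs_nonneg _).trans (hU.sub_one r₁ le_rfl)
  have hK0 : 0 ≤ K := by rw [hK]; positivity
  have h := (abs_le.mp (hU.abs_lagrangianExcess_sub_le hr hx hw hv hu)).1
  rw [← hK] at h
  set δ := ‖w - x‖
  set η := ‖u - v‖
  have hδ : 0 ≤ δ := norm_nonneg _
  have hη0 : 0 ≤ η := norm_nonneg _
  have hin : inner ℝ (w - x) (u - v) ≤ δ * η := real_inner_le_norm _ _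
  have h2 : (2 - ξ) * (2 * inner ℝ (w - x) (u - v)) ≤ 2 * (2 * (δ * η)) := by
    have : (2 - ξ) * (2 * inner ℝ (w - x) (u - v)) ≤ (2 - ξ) * (2 * (δ * η)) := by
      have : 0 ≤ 2 - ξ := by linarith [hξ.2]
      gcongr
    have h3 : 0 ≤ ξ * (2 * (δ * η)) := by have := hξ.1; positivity
    linarith
  have h3 := mul_le_mul_of_nonneg_left h2 (by positivity : 0 ≤ 2 * K)
  -- `8 K δ η ≤ K (δ² + 16 η²)`, and `17 K η² ≤ η² / 2`
  nlinarith [mul_nonneg hK0 (sq_nonneg (δ - 4 * η)), mul_nonneg (sub_nonneg.mpr hK') (sq_nonneg η)]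

namespace IsOpticalRay

variable {U : ℝ → ℝ} {E E' : ℝ} {x v x' v' : ℝ → Vec3}

/-- Two rays with the same starting point, in a nearly flat metric: the half square of the energy
is a convex function of the end point, with the final momentum as a subgradient. -/
theorem inner_momentum_le (h : IsOpticalRay U E x v) (h' : IsOpticalRay U E' x' v')
    {ε r₁ S K : ℝ} (hU : NearlyFlat U ε r₁) (hr : 0 < r₁) (hK : K = ε * (1 + S) ^ 2)
    (hK' : 34 * K ≤ 1)
    (hx : ∀ ξ ∈ Icc (0 : ℝ) 1, r₁ ≤ ‖x ξ‖ ∧ ‖v ξ‖ ≤ S)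
    (hx' : ∀ ξ ∈ Icc (0 : ℝ) 1, r₁ ≤ ‖x' ξ‖ ∧ ‖v' ξ‖ ≤ S) (h0 : x' 0 = x 0) :
    inner ℝ (U ‖x 1‖ • v 1) (x' 1 - x 1) ≤ 1 / 2 * E' ^ 2 - 1 / 2 * E ^ 2 := by
  have hε : 0 ≤ ε := (abs_nonneg _).trans (hU.sub_one r₁ le_rfl)
  have hK0 : 0 ≤ K := by rw [hK]; positivity
  have hd : ∀ ξ ∈ Icc (0 : ℝ) 1, HasDerivWithinAt (fun s => x' s - x s) (v' ξ - v ξ) (Icc 0 1) ξ :=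
    fun ξ hξ => (h'.hasDeriv ξ hξ).sub (h.hasDeriv ξ hξ)
  have key := le_of_hasDerivWithinAt_nonneg
    (f := fun s => (1 / 2 * E' ^ 2 - 1 / 2 * E ^ 2) * s -
      inner ℝ (U ‖x s‖ • v s) (x' s - x s) - 2 * K * ((2 - s) * ‖x' s - x s‖ ^ 2))
    (fun ξ hξ => (((hasDerivWithinAt_id ξ (Icc 0 1)).const_mul
      (1 / 2 * E' ^ 2 - 1 / 2 * E ^ 2)).sub
      ((h.hasDeriv_momentum ξ hξ).inner ℝ (hd ξ hξ))).sub
      ((((hasDerivWithinAt_id ξ (Icc 0 1)).const_sub 2).mul (hd ξ hξ).norm_sq).const_mul (2 * K)))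
    (fun ξ hξ => ?_)
  · simp only [h0, sub_self, inner_zero_right, norm_zero] at key
    have : 0 ≤ 2 * K * ((2 - 1) * ‖x' 1 - x 1‖ ^ 2) := by norm_num; positivity
    linarith
  · have := hU.le_lagrangianExcess hr hK hK' hξ (hx ξ hξ).1 (hx' ξ hξ).1 (hx ξ hξ).2 (hx' ξ hξ).2
    rw [lagrangianExcess, h.null ξ hξ, h'.null ξ hξ] at this
    simp only [id]
    linarith

/-- The convex function of `inner_momentum_le` is at most quadratically above its tangent plane:
the path obtained by adding `ξ (x'(1) - x(1))` to the ray `x` is compared with both rays. -/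
theorem le_inner_momentum (h : IsOpticalRay U E x v) (h' : IsOpticalRay U E' x' v')
    {ε r₁ S K : ℝ} (hU : NearlyFlat U ε r₁) (hr : 0 < r₁) (hK : K = ε * (1 + S) ^ 2)
    (hK' : 34 * K ≤ 1)
    (hx : ∀ ξ ∈ Icc (0 : ℝ) 1, r₁ ≤ ‖x ξ‖ ∧ ‖v ξ‖ ≤ S)
    (hx' : ∀ ξ ∈ Icc (0 : ℝ) 1, r₁ ≤ ‖x' ξ‖ ∧ ‖v' ξ‖ ≤ S)
    (hw : ∀ ξ ∈ Icc (0 : ℝ) 1, r₁ ≤ ‖x ξ + ξ • (x' 1 - x 1)‖ ∧ ‖v ξ + (x' 1 - x 1)‖ ≤ S)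
    (h0 : x' 0 = x 0) :
    1 / 2 * E' ^ 2 - 1 / 2 * E ^ 2 ≤
      inner ℝ (U ‖x 1‖ • v 1) (x' 1 - x 1) + ‖x' 1 - x 1‖ ^ 2 := by
  have hε : 0 ≤ ε := (abs_nonneg _).trans (hU.sub_one r₁ le_rfl)
  have hK0 : 0 ≤ K := by rw [hK]; positivity
  set Δ := x' 1 - x 1 with hΔ
  have hΔd : ∀ ξ, HasDerivWithinAt (fun s : ℝ => s • Δ) Δ (Icc 0 1) ξ := by
    intro ξ
    simpa using (hasDerivWithinAt_id ξ (Icc (0 : ℝ) 1)).smul_const Δ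
  have hd : ∀ ξ ∈ Icc (0 : ℝ) 1, HasDerivWithinAt (fun s => x s + s • Δ - x' s)
      (v ξ + Δ - v' ξ) (Icc 0 1) ξ :=
    fun ξ hξ => ((h.hasDeriv ξ hξ).add (hΔd ξ)).sub (h'.hasDeriv ξ hξ)
  have key := le_of_hasDerivWithinAt_nonneg
    (f := fun s => ‖Δ‖ ^ 2 * s - (1 / 2 * E' ^ 2 - 1 / 2 * E ^ 2) * s +
      inner ℝ (U ‖x s‖ • v s) (s • Δ) - inner ℝ (U ‖x' s‖ • v' s) (x s + s • Δ - x' s) -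
      2 * K * ((2 - s) * ‖x s + s • Δ - x' s‖ ^ 2))
    (fun ξ hξ => (((((hasDerivWithinAt_id ξ (Icc 0 1)).const_mul (‖Δ‖ ^ 2)).sub
      ((hasDerivWithinAt_id ξ (Icc 0 1)).const_mul (1 / 2 * E' ^ 2 - 1 / 2 * E ^ 2))).add
      ((h.hasDeriv_momentum ξ hξ).inner ℝ (hΔd ξ))).sub
      ((h'.hasDeriv_momentum ξ hξ).inner ℝ (hd ξ hξ))).sub
      ((((hasDerivWithinAt_id ξ (Icc 0 1)).const_sub 2).mul (hd ξ hξ).norm_sq).const_mul (2 * K)))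
    (fun ξ hξ => ?_)
  · have e1 : x 1 + Δ - x' 1 = 0 := by rw [hΔ]; simp
    simp only [h0, zero_smul, one_smul, e1, add_zero, sub_self, inner_zero_right, norm_zero] at key
    linarith
  · have h1 := hU.le_lagrangianExcess hr hK hK' hξ (hx' ξ hξ).1 (hw ξ hξ).1 (hx' ξ hξ).2
      (hw ξ hξ).2
    have h2 := (abs_le.mp (hU.abs_lagrangianExcess_sub_le hr (hx ξ hξ).1 (hw ξ hξ).1 (hx ξ hξ).2
      (hw ξ hξ).2)).2
    rw [lagrangianExcess, h'.null ξ hξ] at h1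
    rw [lagrangianExcess, h.null ξ hξ, ← hK, add_sub_cancel_left, add_sub_cancel_left] at h2
    have h3 : ‖ξ • Δ‖ ^ 2 ≤ ‖Δ‖ ^ 2 := by
      rw [norm_smul, Real.norm_eq_abs, abs_of_nonneg hξ.1]
      exact pow_le_pow_left₀ (mul_nonneg hξ.1 (norm_nonneg _))
        (mul_le_of_le_one_left (norm_nonneg _) hξ.2) 2
    have h4 : K * (‖ξ • Δ‖ ^ 2 + ‖Δ‖ ^ 2) ≤ 1 / 2 * ‖Δ‖ ^ 2 := by
      nlinarith [mul_le_mul_of_nonneg_left h3 hK0, mul_nonneg (sub_nonneg.mpr hK') (sq_nonneg ‖Δ‖)]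
    simp only [id]
    linarith

/-- Uniqueness of the energy of a ray joining two given points. -/
theorem energy_eq (h : IsOpticalRay U E x v) (h' : IsOpticalRay U E' x' v')
    {ε r₁ S K : ℝ} (hU : NearlyFlat U ε r₁) (hr : 0 < r₁) (hK : K = ε * (1 + S) ^ 2)
    (hK' : 34 * K ≤ 1)
    (hx : ∀ ξ ∈ Icc (0 : ℝ) 1, r₁ ≤ ‖x ξ‖ ∧ ‖v ξ‖ ≤ S)
    (hx' : ∀ ξ ∈ Icc (0 : ℝ) 1, r₁ ≤ ‖x' ξ‖ ∧ ‖v' ξ‖ ≤ S) (h0 : x' 0 = x 0) (h1 : x' 1 = x 1)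
    (hE : 0 < E) (hE' : 0 < E') : E' = E := by
  have a := h.inner_momentum_le h' hU hr hK hK' hx hx' h0
  have b := h'.inner_momentum_le h hU hr hK hK' hx' hx h0.symm
  rw [h1, sub_self, inner_zero_right] at a
  rw [h1, sub_self, inner_zero_right] at b
  rw [← sq_eq_sq₀ hE'.le hE.le]
  linarith

end IsOpticalRay

/-! ### Estimates on the potential -/

/-- The potential, see `potential_eq`, as a function of `s = m / r`. -/
noncomputable def potentialSeries (κ : ℕ → ℝ) (s : ℝ) : ℝ :=
  1 + ∑' n : ℕ, 2 * κ (n + 1) * s ^ (n + 1)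

/-- The coefficients of `potentialSeries`, with constant term `1`. -/
noncomputable def potentialCoeff (κ : ℕ → ℝ) (n : ℕ) : ℝ := if n = 0 then 1 else 2 * κ n

theorem potential_eq (κ : ℕ → ℝ) (m r : ℝ) : potential κ m r = potentialSeries κ (m / r) := rfl

theorem summable_potentialCoeff {κ : ℕ → ℝ} {m rh : ℝ} (hm : 0 < m) (hrh : 0 < rh)
    (hsum : ∀ r, rh < r → Summable (fun n : ℕ => κ (n + 1) * (m / r) ^ (n + 1))) {s : ℝ}
    (hs0 : 0 ≤ s) (hs : s < m / rh) : Summable fun n => ‖potentialCoeff κ n‖ * s ^ n := by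
  rw [← summable_nat_add_iff 1]
  rcases hs0.eq_or_lt with rfl | hpos
  · simp
  have h1 : rh < m / s := by rw [lt_div_iff₀ hpos]; rw [lt_div_iff₀ hrh] at hs; linarith
  have h2 := ((hsum _ h1).mul_left 2).norm
  refine h2.congr fun n => ?_
  have h3 : m / (m / s) = s := by field_simp
  rw [h3, norm_mul, norm_mul, potentialCoeff, if_neg (Nat.succ_ne_zero n), norm_mul, norm_pow,
    Real.norm_of_nonneg hpos.le]
  ring

theorem potentialSeries_eq {κ : ℕ → ℝ} {s : ℝ}
    (h : Summable fun n => ‖potentialCoeff κ n * s ^ n‖) :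
    potentialSeries κ s = ∑' n, potentialCoeff κ n * s ^ n := by
  rw [h.of_norm.tsum_eq_zero_add]
  simp [potentialSeries, potentialCoeff]

theorem analyticOnNhd_potentialSeries {κ : ℕ → ℝ} {m rh : ℝ} (hm : 0 < m) (hrh : 0 < rh)
    (hsum : ∀ r, rh < r → Summable (fun n : ℕ => κ (n + 1) * (m / r) ^ (n + 1))) :
    AnalyticOnNhd ℝ (potentialSeries κ) (Metric.ball 0 (m / rh)) := by
  intro s hs
  rw [mem_ball_zero_iff] at hs
  obtain ⟨σ, h1, h2⟩ := exists_between hs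
  have hσ : 0 < σ := (norm_nonneg s).trans_lt h1
  have hS := summable_potentialCoeff hm hrh hsum hσ.le h2
  have hf := hasFPowerSeriesOnBall_tsum hσ hS
  have hmem : s ∈ Metric.eball (0 : ℝ) (ENNReal.ofReal σ) := by
    rw [Metric.eball_ofReal]; simpa using h1
  refine (hf.analyticAt_of_mem hmem).congr ?_
  filter_upwards [Metric.isOpen_eball.mem_nhds hmem] with t ht
  rw [Metric.eball_ofReal, mem_ball_zero_iff] at ht
  refine (potentialSeries_eq (Summable.of_nonneg_of_le (fun n => norm_nonneg _) (fun n => ?_)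
    hS)).symm
  rw [norm_mul, norm_pow]
  gcongr

theorem hasDerivAt_potential {κ : ℕ → ℝ} {m rh : ℝ} (hm : 0 < m) (hrh : 0 < rh)
    (hsum : ∀ r, rh < r → Summable (fun n : ℕ => κ (n + 1) * (m / r) ^ (n + 1))) {l r : ℝ}
    (hl : 0 ≤ l) (hr : 0 < r) (hlr : l * rh < r) :
    HasDerivAt (potential κ (l * m))
      (deriv (potentialSeries κ) (l * m / r) * -(l * m / r ^ 2)) r := by
  have hmem : l * m / r ∈ Metric.ball (0 : ℝ) (m / rh) := by
    rw [mem_ball_zero_iff, Real.norm_of_nonneg (by positivity), div_lt_div_iff₀ hr hrh]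
    nlinarith
  have h1 := (analyticOnNhd_potentialSeries hm hrh hsum _ hmem).differentiableAt.hasDerivAt
  have h2 : HasDerivAt (fun r => l * m / r) (-(l * m / r ^ 2)) r := by
    refine ((hasDerivAt_inv hr.ne').const_mul (l * m)).congr_deriv ?_
    field_simp
  exact h1.comp r h2

/-- The second order increment of `1 / ‖x‖`, valid without restriction on the segment from `x` to
`y`, which may cross the ball of radius `r₁`. -/
theorem abs_inv_norm_taylor_le {r₁ : ℝ} (hr : 0 < r₁) {x y : Vec3} (hx : r₁ ≤ ‖x‖) (hy : r₁ ≤ ‖y‖) :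
    |1 / ‖y‖ - 1 / ‖x‖ + inner ℝ x (y - x) / ‖x‖ ^ 3| ≤ 2 / r₁ ^ 3 * ‖y - x‖ ^ 2 := by
  have hin : inner ℝ x (y - x) = (‖y‖ ^ 2 - ‖x‖ ^ 2 - ‖y - x‖ ^ 2) / 2 := by
    rw [norm_sub_sq_real, inner_sub_right, real_inner_self_eq_norm_sq, real_inner_comm]; ring
  have hδ : |‖y‖ - ‖x‖| ≤ ‖y - x‖ := abs_norm_sub_norm_le y x
  rw [hin]
  set r := ‖x‖
  set r' := ‖y‖
  set δ := ‖y - x‖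
  have hr0 : 0 < r := hr.trans_le hx
  have hr0' : 0 < r' := hr.trans_le hy
  have hkey : 1 / r' - 1 / r + (r' ^ 2 - r ^ 2 - δ ^ 2) / 2 / r ^ 3 =
      (r' - r) ^ 2 * (1 / (2 * r ^ 3) + 1 / (r ^ 2 * r')) - δ ^ 2 * (1 / (2 * r ^ 3)) := by
    field_simp
    ring
  have hsq : (r' - r) ^ 2 ≤ δ ^ 2 := by rw [← sq_abs (r' - r)]; gcongr
  have h1 : 1 / (2 * r ^ 3) ≤ 1 / (2 * r₁ ^ 3) := by gcongr
  have h2 : 1 / (r ^ 2 * r') ≤ 1 / r₁ ^ 3 := by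
    have : r₁ ^ 3 ≤ r ^ 2 * r' := by
      calc r₁ ^ 3 = r₁ ^ 2 * r₁ := by ring
        _ ≤ _ := by gcongr
    gcongr
  have h3 : 1 / (2 * r₁ ^ 3) = 1 / 2 * (1 / r₁ ^ 3) := by field_simp
  have h4 : 2 / r₁ ^ 3 = 2 * (1 / r₁ ^ 3) := by field_simp
  have p1 : 0 ≤ 1 / (2 * r ^ 3) := by positivity
  have p2 : 0 ≤ 1 / (r ^ 2 * r') := by positivity
  rw [hkey, h4]
  rw [h3] at h1
  set A := 1 / (2 * r ^ 3)
  set B := 1 / (r ^ 2 * r')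
  set C := 1 / r₁ ^ 3
  have q1 : (r' - r) ^ 2 * (A + B) ≤ δ ^ 2 * (2 * C) :=
    mul_le_mul hsq (by linarith) (by positivity) (by positivity)
  have q2 : δ ^ 2 * A ≤ δ ^ 2 * (2 * C) := by
    refine mul_le_mul_of_nonneg_left ?_ (sq_nonneg δ); linarith
  have q3 : 0 ≤ (r' - r) ^ 2 * (A + B) := by positivity
  have q4 : 0 ≤ δ ^ 2 * A := by positivity
  rw [abs_le]
  constructor <;> linarith

/-- For a small gravitational constant the metric is nearly flat. -/
theorem exists_nearlyFlat_potential {κ : ℕ → ℝ} {m rh : ℝ} (hm : 0 < m) (hrh : 0 < rh)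
    (hsum : ∀ r, rh < r → Summable (fun n : ℕ => κ (n + 1) * (m / r) ^ (n + 1))) :
    ∃ C : ℝ, 0 ≤ C ∧ ∀ l ∈ Icc (0 : ℝ) (1 / 2), NearlyFlat (potential κ (l * m)) (C * l) rh := by
  set P := potentialSeries κ
  set I : Set ℝ := Icc 0 (m / rh / 2)
  have hs0 : 0 < m / rh := by positivity
  have hI : I ⊆ Metric.ball 0 (m / rh) := by
    intro s hs
    rw [mem_ball_zero_iff, Real.norm_of_nonneg hs.1]
    linarith [hs.2]
  have hP : AnalyticOnNhd ℝ P (Metric.ball 0 (m / rh)) := analyticOnNhd_potentialSeries hm hrh hsum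
  have hP' := hP.deriv
  have hP'' := hP'.deriv
  obtain ⟨C₁, hC₁⟩ := (isCompact_Icc (a := (0 : ℝ)) (b := m / rh / 2)).exists_bound_of_continuousOn
    (hP'.continuousOn.mono hI)
  obtain ⟨C₂, hC₂⟩ := (isCompact_Icc (a := (0 : ℝ)) (b := m / rh / 2)).exists_bound_of_continuousOn
    (hP''.continuousOn.mono hI)
  have h0I : (0 : ℝ) ∈ I := ⟨le_rfl, by positivity⟩
  have hC₁0 : 0 ≤ C₁ := (norm_nonneg _).trans (hC₁ 0 h0I)
  have hC₂0 : 0 ≤ C₂ := (norm_nonneg _).trans (hC₂ 0 h0I)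
  have hconv : Convex ℝ I := convex_Icc _ _
  have hlip : ∀ s ∈ I, ∀ t ∈ I, |P t - P s| ≤ C₁ * |t - s| := fun s hs t ht =>
    hconv.norm_image_sub_le_of_norm_hasDerivWithin_le
      (fun u hu => (hP u (hI hu)).differentiableAt.hasDerivAt.hasDerivWithinAt) hC₁ hs ht
  have hlip' : ∀ s ∈ I, ∀ t ∈ I, |deriv P t - deriv P s| ≤ C₂ * |t - s| := fun s hs t ht =>
    hconv.norm_image_sub_le_of_norm_hasDerivWithin_le
      (fun u hu => (hP' u (hI hu)).differentiableAt.hasDerivAt.hasDerivWithinAt) hC₂ hs ht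
  have htay : ∀ s ∈ I, ∀ t ∈ I, |P t - P s - deriv P s * (t - s)| ≤ C₂ * |t - s| ^ 2 := by
    intro s hs t ht
    have hsub : uIcc s t ⊆ I := (ordConnected_Icc).uIcc_subset hs ht
    have h := (convex_uIcc s t).norm_image_sub_le_of_norm_hasDerivWithin_le
      (f := fun u => P u - deriv P s * u) (f' := fun u => deriv P u - deriv P s * 1)
      (C := C₂ * |t - s|)
      (fun u hu => (((hP u (hI (hsub hu))).differentiableAt.hasDerivAt).sub
        ((hasDerivAt_id u).const_mul _)).hasDerivWithinAt)
      (fun u hu => ?_) left_mem_uIcc right_mem_uIcc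
    · rw [Real.norm_eq_abs, Real.norm_eq_abs] at h
      calc _ = |P t - deriv P s * t - (P s - deriv P s * s)| := by congr 1; ring
        _ ≤ C₂ * |t - s| * |t - s| := h
        _ = _ := by ring
    · rw [mul_one, Real.norm_eq_abs]
      refine (hlip' s hs u (hsub hu)).trans ?_
      exact mul_le_mul_of_nonneg_left (abs_sub_left_of_mem_uIcc hu) hC₂0
  refine ⟨C₁ * (m / rh) + C₁ * (m / rh ^ 2) + (C₂ * (m / rh ^ 2) ^ 2 + C₁ * m * (2 / rh ^ 3)),
    by positivity, fun l hl => ?_⟩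
  have hl0 := hl.1
  have hmem : ∀ r ≥ rh, l * m / r ∈ I := by
    intro r hr
    have hr0 : 0 < r := hrh.trans_le hr
    refine ⟨by positivity, ?_⟩
    calc l * m / r ≤ 1 / 2 * m / rh := by
          have := hl.2
          gcongr
      _ = m / rh / 2 := by ring
  have hder : ∀ r ≥ rh, deriv (potential κ (l * m)) r = deriv P (l * m / r) * -(l * m / r ^ 2) := by
    intro r hr
    have hr0 : 0 < r := hrh.trans_le hr
    refine (hasDerivAt_potential hm hrh hsum hl0 hr0 ?_).deriv
    have := hl.2
    nlinarith
  have hn1 : 0 ≤ C₁ * (m / rh) * l := by positivity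
  have hn2 : 0 ≤ C₁ * (m / rh ^ 2) * l := by positivity
  have hn3 : 0 ≤ (C₂ * (m / rh ^ 2) ^ 2 + C₁ * m * (2 / rh ^ 3)) * l := by positivity
  refine ⟨fun r hr => ?_, fun r hr => ?_, fun x y hx hy => ?_⟩
  · have hr0 : 0 < r := hrh.trans_le hr
    have h0 : P 0 = 1 := by simp [P, potentialSeries]
    have h := hlip 0 h0I _ (hmem r hr)
    rw [h0, sub_zero, abs_of_nonneg (hmem r hr).1] at h
    rw [potential_eq]
    have : C₁ * (l * m / r) ≤ C₁ * (m / rh) * l := by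
      have : l * m / r ≤ l * m / rh := by gcongr
      calc C₁ * (l * m / r) ≤ C₁ * (l * m / rh) := by gcongr
        _ = _ := by ring
    linarith
  · have hr0 : 0 < r := hrh.trans_le hr
    rw [hder r hr, abs_mul, abs_neg, abs_of_nonneg (by positivity : 0 ≤ l * m / r ^ 2)]
    have h := hC₁ _ (hmem r hr)
    have : |deriv P (l * m / r)| * (l * m / r ^ 2) ≤ C₁ * (m / rh ^ 2) * l := by
      have h2 : l * m / r ^ 2 ≤ l * m / rh ^ 2 := by gcongr
      calc _ ≤ C₁ * (l * m / rh ^ 2) := mul_le_mul h h2 (by positivity) hC₁0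
        _ = _ := by ring
    linarith
  · have hx0 : 0 < ‖x‖ := hrh.trans_le hx
    have hy0 : 0 < ‖y‖ := hrh.trans_le hy
    rw [hder _ hx, potential_eq, potential_eq]
    set s := l * m / ‖x‖ with hs
    set t := l * m / ‖y‖ with ht
    have hsI : s ∈ I := hmem _ hx
    have htI : t ∈ I := hmem _ hy
    have e : P t - P s - deriv P s * -(l * m / ‖x‖ ^ 2) / ‖x‖ * inner ℝ x (y - x) =
        (P t - P s - deriv P s * (t - s)) + deriv P s * (l * m) *
          (1 / ‖y‖ - 1 / ‖x‖ + inner ℝ x (y - x) / ‖x‖ ^ 3) := by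
      rw [hs, ht]; field_simp; ring
    rw [e]
    have hts : |t - s| ≤ l * (m / rh ^ 2) * ‖y - x‖ := by
      have e2 : t - s = l * m * ((‖x‖ - ‖y‖) / (‖x‖ * ‖y‖)) := by rw [hs, ht]; field_simp
      rw [e2, abs_mul, abs_div, abs_of_nonneg (by positivity : 0 ≤ l * m),
        abs_of_pos (by positivity : 0 < ‖x‖ * ‖y‖), abs_sub_comm]
      have h1 : |‖y‖ - ‖x‖| ≤ ‖y - x‖ := abs_norm_sub_norm_le y x
      have h2 : rh ^ 2 ≤ ‖x‖ * ‖y‖ := by rw [sq]; gcongr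
      calc l * m * (|‖y‖ - ‖x‖| / (‖x‖ * ‖y‖)) ≤ l * m * (‖y - x‖ / rh ^ 2) := by gcongr
        _ = _ := by ring
    have hl1 : l ^ 2 ≤ l := by nlinarith [hl.2]
    have b1 : |P t - P s - deriv P s * (t - s)| ≤ C₂ * (m / rh ^ 2) ^ 2 * l * ‖y - x‖ ^ 2 := by
      refine (htay s hsI t htI).trans ?_
      calc C₂ * |t - s| ^ 2 ≤ C₂ * (l * (m / rh ^ 2) * ‖y - x‖) ^ 2 := by gcongr
        _ = C₂ * (m / rh ^ 2) ^ 2 * l ^ 2 * ‖y - x‖ ^ 2 := by ring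
        _ ≤ _ := by gcongr
    have b2 : |deriv P s * (l * m) * (1 / ‖y‖ - 1 / ‖x‖ + inner ℝ x (y - x) / ‖x‖ ^ 3)| ≤
        C₁ * m * (2 / rh ^ 3) * l * ‖y - x‖ ^ 2 := by
      rw [abs_mul, abs_mul, abs_of_nonneg (by positivity : 0 ≤ l * m)]
      have h1 : |deriv P s| ≤ C₁ := hC₁ s hsI
      calc _ ≤ C₁ * (l * m) * (2 / rh ^ 3 * ‖y - x‖ ^ 2) := by
            gcongr
            exact abs_inv_norm_taylor_le hrh hx hy
        _ = _ := by ring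
    have b3 := abs_add_le (P t - P s - deriv P s * (t - s))
      (deriv P s * (l * m) * (1 / ‖y‖ - 1 / ‖x‖ + inner ℝ x (y - x) / ‖x‖ ^ 3))
    have n1 := mul_nonneg hn1 (sq_nonneg ‖y - x‖)
    have n2 := mul_nonneg hn2 (sq_nonneg ‖y - x‖)
    linarith

/-! ### Families of quasi-Minkowskian rays -/

/-- The spatial part of `rayPath`. -/
noncomputable def rayPosition (X : ℕ → Vec3 → Vec3 → ℝ → Vec3) (y : Vec3 × Vec3) (l ξ : ℝ) : Vec3 :=
  segmentPoint y.1 y.2 ξ + ∑' n : ℕ, l ^ (n + 1) • X (n + 1) y.1 y.2 ξ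

/-- The spatial part of `rayTangent`. -/
noncomputable def rayVelocity (X : ℕ → Vec3 → Vec3 → ℝ → Vec3) (y : Vec3 × Vec3) (l ξ : ℝ) : Vec3 :=
  (y.2 - y.1) + ∑' n : ℕ, l ^ (n + 1) • derivWithin (X (n + 1) y.1 y.2) (Icc 0 1) ξ

/-- The energy of a quasi-Minkowskian light ray: the time component of `rayTangent` at `ξ = 0`. -/
noncomputable def rayEnergy (X0 : ℕ → Vec3 → Vec3 → ℝ → ℝ) (y : Vec3 × Vec3) (l : ℝ) : ℝ :=
  ‖y.2 - y.1‖ + ∑' n : ℕ, l ^ (n + 1) * derivWithin (X0 (n + 1) y.1 y.2) (Icc 0 1) 0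

/-- The coefficients of the energy as a power series in the gravitational constant.  As the energy
is constant and `ξ` runs over an interval of length one, they are the coefficients of
`x⁰(1) - x⁰(0)`. -/
noncomputable def energyCoeff (X0 : ℕ → Vec3 → Vec3 → ℝ → ℝ) (y : Vec3 × Vec3) (n : ℕ) : ℝ :=
  if n = 0 then ‖y.2 - y.1‖ else X0 n y.1 y.2 1

/-- The coefficients of the final velocity as a power series in the gravitational constant. -/
noncomputable def velocityCoeff (X : ℕ → Vec3 → Vec3 → ℝ → Vec3) (y : Vec3 × Vec3) (n : ℕ) : Vec3 :=
  if n = 0 then y.2 - y.1 else derivWithin (X n y.1 y.2) (Icc 0 1) 1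

theorem norm_tsum_pow_smul_le {F : Type*} [NormedAddCommGroup F] [NormedSpace ℝ F] {f : ℕ → F}
    {M : ℕ → ℝ} {l : ℝ} (hl : l ∈ Icc (0 : ℝ) 1) (hM : Summable fun n => M (n + 1))
    (hf : ∀ n ≥ 1, ‖f n‖ ≤ M n) :
    ‖∑' n, l ^ (n + 1) • f (n + 1)‖ ≤ l * ∑' n, M (n + 1) := by
  refine tsum_of_norm_bounded (hM.hasSum.mul_left l) fun n => ?_
  have h := hf (n + 1) (by omega)
  have h0 := (norm_nonneg _).trans h
  have hl0 := hl.1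
  rw [norm_smul, norm_pow, Real.norm_of_nonneg hl0, pow_succ']
  have h1 : l ^ n ≤ 1 := pow_le_one₀ hl0 hl.2
  calc l * l ^ n * ‖f (n + 1)‖ ≤ l * 1 * M (n + 1) := by gcongr
    _ = _ := by ring

theorem summable_pow_smul {F : Type*} [NormedAddCommGroup F] [NormedSpace ℝ F] [CompleteSpace F]
    {f : ℕ → F} {M : ℕ → ℝ} {l : ℝ} (hl : l ∈ Icc (0 : ℝ) 1) (hM : Summable fun n => M (n + 1))
    (hf : ∀ n ≥ 1, ‖f n‖ ≤ M n) : Summable fun n => l ^ n • f n := by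
  rw [← summable_nat_add_iff 1]
  refine Summable.of_norm_bounded hM fun n => ?_
  have h := hf (n + 1) (by omega)
  have hl0 := hl.1
  rw [norm_smul, norm_pow, Real.norm_of_nonneg hl0]
  have h1 : l ^ (n + 1) ≤ 1 := pow_le_one₀ hl0 hl.2
  calc l ^ (n + 1) * ‖f (n + 1)‖ ≤ 1 * M (n + 1) := by gcongr
    _ = _ := by ring

theorem summable_succ_of_summable_mul_pow {M : ℕ → ℝ} {R : ℝ} (hR : 1 < R)
    (hM : Summable fun n => M n * R ^ n) (h0 : ∀ n ≥ 1, 0 ≤ M n) :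
    Summable fun n => M (n + 1) := by
  refine Summable.of_nonneg_of_le (fun n => h0 _ (by omega)) (fun n => ?_)
    ((summable_nat_add_iff (f := fun n => M n * R ^ n) 1).mpr hM)
  exact le_mul_of_one_le_right (h0 _ (by omega)) (one_le_pow₀ hR.le)

namespace IsQuasiMinkowskian

variable {κ : ℕ → ℝ} {m rh c tA : ℝ} {O : Set (Vec3 × Vec3)}
  {X0 : ℕ → Vec3 → Vec3 → ℝ → ℝ} {X : ℕ → Vec3 → Vec3 → ℝ → Vec3}

theorem rayPosition_zero (h : IsQuasiMinkowskian κ m rh c tA O X0 X) {y : Vec3 × Vec3} (hy : y ∈ O)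
    (l : ℝ) : rayPosition X y l 0 = y.1 := by
  have : ∀ n, X (n + 1) y.1 y.2 0 = 0 := fun n => h.pos_zero _ (by omega) y hy
  simp [rayPosition, segmentPoint, this]

theorem rayPosition_one (h : IsQuasiMinkowskian κ m rh c tA O X0 X) {y : Vec3 × Vec3} (hy : y ∈ O)
    (l : ℝ) : rayPosition X y l 1 = y.2 := by
  have : ∀ n, X (n + 1) y.1 y.2 1 = 0 := fun n => h.pos_one _ (by omega) y hy
  simp [rayPosition, segmentPoint, this]

theorem rayPosition_ne_zero (h : IsQuasiMinkowskian κ m rh c tA O X0 X) (hrh : 0 < rh)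
    {y : Vec3 × Vec3} (hy : y ∈ O) {l : ℝ} (hl : l ∈ Icc (0 : ℝ) 1) :
    ∀ ξ ∈ Icc (0 : ℝ) 1, rayPosition X y l ξ ≠ 0 := by
  intro ξ hξ h0
  have h1 : l * rh < ‖rayPosition X y l ξ‖ := h.confined y hy l hl ξ hξ
  rw [h0, norm_zero] at h1
  have := mul_nonneg hl.1 hrh.le
  linarith

theorem isOpticalRay_and_time (h : IsQuasiMinkowskian κ m rh c tA O X0 X) (hm : 0 < m)
    (hrh : 0 < rh)
    (hsum : ∀ r, rh < r → Summable (fun n : ℕ => κ (n + 1) * (m / r) ^ (n + 1)))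
    {y : Vec3 × Vec3} (hy : y ∈ O) {l : ℝ} (hl : l ∈ Icc (0 : ℝ) 1) :
    IsOpticalRay (potential κ (l * m)) (rayEnergy X0 y l) (rayPosition X y l) (rayVelocity X y l) ∧
      (∀ ξ ∈ Icc (0 : ℝ) 1, (rayTangent y.1 y.2 (fun n => X0 n y.1 y.2) (fun n => X n y.1 y.2)
        l ξ).1 = rayEnergy X0 y l) ∧
      rayEnergy X0 y l = ‖y.2 - y.1‖ + ∑' n : ℕ, l ^ (n + 1) * X0 (n + 1) y.1 y.2 1 := by
  have hU : ∀ ξ ∈ Icc (0 : ℝ) 1,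
      DifferentiableAt ℝ (potential κ (l * m)) ‖rayPosition X y l ξ‖ := fun ξ hξ =>
    (hasDerivAt_potential hm hrh hsum hl.1
      (norm_pos_iff.mpr (h.rayPosition_ne_zero hrh hy hl ξ hξ))
      (h.confined y hy l hl ξ hξ)).differentiableAt
  obtain ⟨h1, h2, h3⟩ := isOpticalRay_of_isNullGeodesic (h.null_geodesic y hy l hl)
    (h.rayPosition_ne_zero hrh hy hl) hU
  refine ⟨h1, h2, ?_⟩
  have h4 : ∀ n, X0 (n + 1) y.1 y.2 0 = 0 := fun n => h.time_zero _ (by omega) y hy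
  change _ = _ + rayEnergy X0 y l at h3
  simp only [rayPath, h4, zero_mul, mul_zero, tsum_zero, add_zero, one_mul] at h3
  linarith

/-- The norms of the perturbation terms are bounded by a sequence `M` whose generating series
converges at some `R > 1`. -/
theorem exists_bound (h : IsQuasiMinkowskian κ m rh c tA O X0 X) (hne : O.Nonempty) :
    ∃ R > (1 : ℝ), ∃ M : ℕ → ℝ, (∀ n ≥ 1, 0 ≤ M n) ∧ Summable (fun n => M n * R ^ n) ∧
    ∀ n ≥ 1, ∀ y ∈ O, ∀ ξ ∈ Icc (0 : ℝ) 1,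
      |X0 n y.1 y.2 ξ| ≤ M n ∧ ‖X n y.1 y.2 ξ‖ ≤ M n ∧
      ‖derivWithin (X n y.1 y.2) (Icc 0 1) ξ‖ ≤ M n := by
  obtain ⟨R, hR, M, hM, hb⟩ := h.normal_conv
  obtain ⟨y, hy⟩ := hne
  exact ⟨R, hR, M, fun n hn => (abs_nonneg _).trans (hb n hn y hy 0 (by simp)).1, hM,
    fun n hn y hy ξ hξ => ⟨(hb n hn y hy ξ hξ).1, (hb n hn y hy ξ hξ).2.2.1,
      (hb n hn y hy ξ hξ).2.2.2⟩⟩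

theorem hasSum_energyCoeff (h : IsQuasiMinkowskian κ m rh c tA O X0 X) (hm : 0 < m)
    (hrh : 0 < rh)
    (hsum : ∀ r, rh < r → Summable (fun n : ℕ => κ (n + 1) * (m / r) ^ (n + 1)))
    {y : Vec3 × Vec3} (hy : y ∈ O) {l : ℝ} (hl : l ∈ Icc (0 : ℝ) 1) :
    HasSum (fun n => l ^ n * energyCoeff X0 y n) (rayEnergy X0 y l) := by
  obtain ⟨R, hR, M, hM0, hM, hb⟩ := h.exists_bound ⟨y, hy⟩
  have hs : Summable fun n => l ^ n * energyCoeff X0 y n :=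
    summable_pow_smul hl (summable_succ_of_summable_mul_pow hR hM hM0) fun n hn => by
      rw [energyCoeff, if_neg (by omega)]
      exact (hb n hn y hy 1 (by simp)).1
  rw [(h.isOpticalRay_and_time hm hrh hsum hy hl).2.2]
  convert hs.hasSum using 1
  rw [hs.tsum_eq_zero_add]
  simp [energyCoeff]

theorem hasSum_velocityCoeff (h : IsQuasiMinkowskian κ m rh c tA O X0 X)
    {y : Vec3 × Vec3} (hy : y ∈ O) {l : ℝ} (hl : l ∈ Icc (0 : ℝ) 1) :
    HasSum (fun n => l ^ n • velocityCoeff X y n) (rayVelocity X y l 1) := by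
  obtain ⟨R, hR, M, hM0, hM, hb⟩ := h.exists_bound ⟨y, hy⟩
  have hs : Summable fun n => l ^ n • velocityCoeff X y n :=
    summable_pow_smul hl (summable_succ_of_summable_mul_pow hR hM hM0) fun n hn => by
      rw [velocityCoeff, if_neg (by omega)]
      exact (hb n hn y hy 1 (by simp)).2.2
  convert hs.hasSum using 1
  rw [hs.tsum_eq_zero_add]
  simp [velocityCoeff, rayVelocity]

theorem rayEnergy_pos (h : IsQuasiMinkowskian κ m rh c tA O X0 X) {y : Vec3 × Vec3} (hy : y ∈ O)
    {l : ℝ} (hl : l ∈ Icc (0 : ℝ) 1) : 0 < rayEnergy X0 y l :=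
  h.future y hy l hl 0 (by simp)

end IsQuasiMinkowskian

/-- The segments with end points near `𝐱_A`, `𝐱_B` stay away from the ball of radius `r_h`. -/
theorem exists_segment_margin {xA xB : Vec3} {rh : ℝ}
    (hseg : ∀ ξ ∈ Icc (0 : ℝ) 1, rh < ‖segmentPoint xA xB ξ‖) :
    ∃ η > 0, ∀ y : Vec3 × Vec3, ‖y.1 - xA‖ < η → ‖y.2 - xB‖ < η → ∀ ξ ∈ Icc (0 : ℝ) 1,
      rh + η ≤ ‖segmentPoint y.1 y.2 ξ‖ := by
  have hcont : ContinuousOn (fun ξ => ‖segmentPoint xA xB ξ‖) (Icc 0 1) := by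
    unfold segmentPoint; fun_prop
  obtain ⟨ξ₀, hξ₀, hmin⟩ := isCompact_Icc.exists_isMinOn (nonempty_Icc.mpr zero_le_one) hcont
  have hlt := hseg ξ₀ hξ₀
  refine ⟨(‖segmentPoint xA xB ξ₀‖ - rh) / 2, by linarith, fun y h1 h2 ξ hξ => ?_⟩
  have h3 : ‖segmentPoint xA xB ξ₀‖ ≤ ‖segmentPoint xA xB ξ‖ := hmin hξ
  have h4 : segmentPoint xA xB ξ =
      segmentPoint y.1 y.2 ξ - ((1 - ξ) • (y.1 - xA) + ξ • (y.2 - xB)) := by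
    rw [segmentPoint, segmentPoint]; module
  have h5 := norm_sub_le (segmentPoint y.1 y.2 ξ) ((1 - ξ) • (y.1 - xA) + ξ • (y.2 - xB))
  rw [← h4] at h5
  have h6 := norm_add_le ((1 - ξ) • (y.1 - xA)) (ξ • (y.2 - xB))
  rw [norm_smul, norm_smul, Real.norm_of_nonneg hξ.1,
    Real.norm_of_nonneg (sub_nonneg.mpr hξ.2)] at h6
  have h7 := mul_le_mul_of_nonneg_left h1.le (sub_nonneg.mpr hξ.2)
  have h8 := mul_le_mul_of_nonneg_left h2.le hξ.1
  linarith

/-- A neighbourhood `W` of the given pair of end points and a bound `l₀` for the gravitational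
constant such that all the rays with end points in `W`, and the paths obtained by tilting them
towards another end point, are subject to the convexity estimates.  The bound
`34 ε (1 + S)² ≤ 1` is the smallness condition under which the Lagrangian is convex for speeds up to `S`. -/
structure IsConvexityRegion (κ : ℕ → ℝ) (m rh : ℝ) (X : ℕ → Vec3 → Vec3 → ℝ → Vec3)
    (W : Set (Vec3 × Vec3)) (S l₀ : ℝ) : Prop where
  pos : 0 < l₀
  le_one : l₀ ≤ 1
  norm_sub_le : ∀ y ∈ W, ‖y.2 - y.1‖ ≤ S
  ne_zero : ∀ y ∈ W, y.1 ≠ 0 ∧ y.2 ≠ 0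
  nearlyFlat : ∀ l ∈ Ioo 0 l₀, ∃ ε, NearlyFlat (potential κ (l * m)) ε rh ∧
    34 * (ε * (1 + S) ^ 2) ≤ 1
  ray : ∀ l ∈ Ioo 0 l₀, ∀ y ∈ W, ∀ ξ ∈ Icc (0 : ℝ) 1,
    rh ≤ ‖rayPosition X y l ξ‖ ∧ ‖rayVelocity X y l ξ‖ ≤ S
  tilted : ∀ l ∈ Ioo 0 l₀, ∀ y ∈ W, ∀ y' ∈ W, y'.1 = y.1 → ∀ ξ ∈ Icc (0 : ℝ) 1,
    rh ≤ ‖rayPosition X y l ξ + ξ • (y'.2 - y.2)‖ ∧ ‖rayVelocity X y l ξ + (y'.2 - y.2)‖ ≤ S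

namespace IsQuasiMinkowskian

variable {κ : ℕ → ℝ} {m rh c tA : ℝ} {O : Set (Vec3 × Vec3)}
  {X0 : ℕ → Vec3 → Vec3 → ℝ → ℝ} {X : ℕ → Vec3 → Vec3 → ℝ → Vec3}

theorem exists_isConvexityRegion (h : IsQuasiMinkowskian κ m rh c tA O X0 X) (hm : 0 < m)
    (hrh : 0 < rh)
    (hsum : ∀ r, rh < r → Summable (fun n : ℕ => κ (n + 1) * (m / r) ^ (n + 1)))
    {xA xB : Vec3} (hO : O ∈ 𝓝 (xA, xB))
    (hseg : ∀ ξ ∈ Icc (0 : ℝ) 1, rh < ‖segmentPoint xA xB ξ‖) :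
    ∃ W ∈ 𝓝 (xA, xB), W ⊆ O ∧ ∃ S l₀, IsConvexityRegion κ m rh X W S l₀ := by
  obtain ⟨η, hη, hmargin⟩ := exists_segment_margin hseg
  obtain ⟨R, hR, M, hM0, hM, hb⟩ := h.exists_bound ⟨_, mem_of_mem_nhds hO⟩
  have hMs := summable_succ_of_summable_mul_pow hR hM hM0
  set Mt := ∑' n, M (n + 1) with hMt
  have hMt0 : 0 ≤ Mt := tsum_nonneg fun n => hM0 _ (by omega)
  obtain ⟨C, hC0, hC⟩ := exists_nearlyFlat_potential hm hrh hsum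
  set S := ‖xB - xA‖ + 4 * η + Mt with hS
  have hS0 : 0 ≤ S := by positivity
  set D := 34 * (C * (1 + S) ^ 2) with hD
  have hD0 : 0 ≤ D := by positivity
  set l₀ := min (1 / 2) (min (η / (Mt + 1)) (1 / (D + 1))) with hl₀
  have hl₀pos : 0 < l₀ := by
    refine lt_min (by norm_num) (lt_min (by positivity) (by positivity))
  have hl_half : l₀ ≤ 1 / 2 := min_le_left _ _
  have hlM : ∀ l ∈ Ioo 0 l₀, l * Mt ≤ η := by
    intro l hl
    have h1 : l ≤ η / (Mt + 1) := hl.2.le.trans ((min_le_right _ _).trans (min_le_left _ _))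
    rw [le_div_iff₀ (by positivity)] at h1
    linarith [hl.1]
  have hlD : ∀ l ∈ Ioo 0 l₀, l * D ≤ 1 := by
    intro l hl
    have h1 : l ≤ 1 / (D + 1) := hl.2.le.trans ((min_le_right _ _).trans (min_le_right _ _))
    rw [le_div_iff₀ (by positivity)] at h1
    linarith [hl.1]
  set W : Set (Vec3 × Vec3) := O ∩ {y | ‖y.1 - xA‖ < η ∧ ‖y.2 - xB‖ < η} with hW
  have hWO : W ⊆ O := inter_subset_left
  have hWn : W ∈ 𝓝 (xA, xB) := by
    refine inter_mem hO ?_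
    have h1 : ContinuousAt (fun y : Vec3 × Vec3 => ‖y.1 - xA‖) (xA, xB) := by fun_prop
    have h2 : ContinuousAt (fun y : Vec3 × Vec3 => ‖y.2 - xB‖) (xA, xB) := by fun_prop
    exact (h1.eventually_lt continuousAt_const (by simpa using hη)).and
      (h2.eventually_lt continuousAt_const (by simpa using hη))
  have hdist : ∀ y ∈ W, ‖y.2 - y.1‖ ≤ ‖xB - xA‖ + 2 * η := by
    intro y hy
    have e : y.2 - y.1 = (xB - xA) + ((y.2 - xB) - (y.1 - xA)) := by abel
    rw [e]
    have h1 := norm_add_le (xB - xA) ((y.2 - xB) - (y.1 - xA))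
    have h2 := norm_sub_le (y.2 - xB) (y.1 - xA)
    linarith [hy.2.1, hy.2.2]
  have hend : ∀ y ∈ W, ∀ y' ∈ W, ‖y'.2 - y.2‖ ≤ 2 * η := by
    intro y hy y' hy'
    have e : y'.2 - y.2 = (y'.2 - xB) - (y.2 - xB) := by abel
    rw [e]
    have h2 := norm_sub_le (y'.2 - xB) (y.2 - xB)
    linarith [hy.2.2, hy'.2.2]
  have hl1 : ∀ l ∈ Ioo 0 l₀, l ∈ Icc (0 : ℝ) 1 := fun l hl =>
    ⟨hl.1.le, by linarith [hl.2]⟩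
  have hvel : ∀ l ∈ Ioo 0 l₀, ∀ y ∈ W, ∀ ξ ∈ Icc (0 : ℝ) 1,
      ‖rayVelocity X y l ξ‖ ≤ ‖xB - xA‖ + 2 * η + Mt := by
    intro l hl y hy ξ hξ
    have h1 := norm_tsum_pow_smul_le (f := fun n => derivWithin (X n y.1 y.2) (Icc 0 1) ξ)
      (hl1 l hl) hMs (fun n hn => (hb n hn y (hWO hy) ξ hξ).2.2)
    have h2 : l * Mt ≤ Mt := mul_le_of_le_one_left hMt0 (hl1 l hl).2
    have h3 := hdist y hy
    exact (norm_add_le _ _).trans (by linarith)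
  have hpos : ∀ l ∈ Ioo 0 l₀, ∀ y ∈ W, ∀ ξ ∈ Icc (0 : ℝ) 1,
      ‖∑' n : ℕ, l ^ (n + 1) • X (n + 1) y.1 y.2 ξ‖ ≤ η := by
    intro l hl y hy ξ hξ
    exact (norm_tsum_pow_smul_le (f := fun n => X n y.1 y.2 ξ)
      (hl1 l hl) hMs (fun n hn => (hb n hn y (hWO hy) ξ hξ).2.1)).trans (hlM l hl)
  have htilt : ∀ l ∈ Ioo 0 l₀, ∀ y ∈ W, ∀ y' ∈ W, y'.1 = y.1 → ∀ ξ ∈ Icc (0 : ℝ) 1,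
      rh ≤ ‖rayPosition X y l ξ + ξ • (y'.2 - y.2)‖ ∧
        ‖rayVelocity X y l ξ + (y'.2 - y.2)‖ ≤ S := by
    intro l hl y hy y' hy' h1 ξ hξ
    constructor
    · have e : rayPosition X y l ξ + ξ • (y'.2 - y.2) =
          segmentPoint y'.1 y'.2 ξ + ∑' n : ℕ, l ^ (n + 1) • X (n + 1) y.1 y.2 ξ := by
        rw [rayPosition, segmentPoint, segmentPoint, h1]; module
      have h2 := hmargin y' hy'.2.1 hy'.2.2 ξ hξ
      have h3 := hpos l hl y hy ξ hξ
      have h4 := norm_sub_le_norm_add (segmentPoint y'.1 y'.2 ξ)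
        (∑' n : ℕ, l ^ (n + 1) • X (n + 1) y.1 y.2 ξ)
      rw [e]
      linarith
    · have h2 := hvel l hl y hy ξ hξ
      have h3 := hend y hy y' hy'
      exact (norm_add_le _ _).trans (by linarith)
  have hrhle : ∀ y ∈ W, rh < ‖y.1‖ ∧ rh < ‖y.2‖ := by
    intro y hy
    have h1 := hmargin y hy.2.1 hy.2.2 0 (by simp)
    have h2 := hmargin y hy.2.1 hy.2.2 1 (by simp)
    simp only [segmentPoint, zero_smul, add_zero, one_smul, add_sub_cancel] at h1 h2
    exact ⟨by linarith, by linarith⟩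
  refine ⟨W, hWn, hWO, S, l₀, hl₀pos, by linarith, fun y hy => (hdist y hy).trans (by linarith),
    fun y hy => ⟨norm_pos_iff.mp (hrh.trans (hrhle y hy).1),
      norm_pos_iff.mp (hrh.trans (hrhle y hy).2)⟩, fun l hl => ⟨C * l, hC l ⟨hl.1.le, ?_⟩, ?_⟩,
    fun l hl y hy ξ hξ => ?_, htilt⟩
  · linarith [hl.2]
  · calc 34 * (C * l * (1 + S) ^ 2) = l * D := by rw [hD]; ring
      _ ≤ 1 := hlD l hl
  · simpa using htilt l hl y hy y hy rfl ξ hξ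

variable {W : Set (Vec3 × Vec3)} {S l₀ : ℝ}

/-- The terms of the time transfer function depend on the two radii and the angle only. -/
theorem energyCoeff_eq (h : IsQuasiMinkowskian κ m rh c tA O X0 X) (hm : 0 < m) (hrh : 0 < rh)
    (hsum : ∀ r, rh < r → Summable (fun n : ℕ => κ (n + 1) * (m / r) ^ (n + 1)))
    (hWO : W ⊆ O) (hW : IsConvexityRegion κ m rh X W S l₀) {y y' : Vec3 × Vec3} (hy : y ∈ W)
    (hy' : y' ∈ W) (h1 : ‖y.1‖ = ‖y'.1‖) (h2 : ‖y.2‖ = ‖y'.2‖)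
    (h3 : cosAngle y.1 y.2 = cosAngle y'.1 y'.2) (n : ℕ) :
    energyCoeff X0 y n = energyCoeff X0 y' n := by
  obtain ⟨R, hR1, hR2⟩ := exists_isometry h1 h2 (inner_eq_of_cosAngle_eq (hW.ne_zero y hy).1
    (hW.ne_zero y hy).2 (hW.ne_zero y' hy').1 (hW.ne_zero y' hy').2 h1 h2 h3)
  have hl1 : ∀ l ∈ Ioo 0 l₀, l ∈ Icc (0 : ℝ) 1 := fun l hl =>
    ⟨hl.1.le, hl.2.le.trans hW.le_one⟩
  have hE : ∀ l ∈ Ioo 0 l₀, rayEnergy X0 y' l = rayEnergy X0 y l := by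
    intro l hl
    have hl' := hl1 l hl
    obtain ⟨ε, hε, hK⟩ := hW.nearlyFlat l hl
    have r1 := (h.isOpticalRay_and_time hm hrh hsum (hWO hy) hl').1.map_isometry R
    have r2 := (h.isOpticalRay_and_time hm hrh hsum (hWO hy') hl').1
    refine r1.energy_eq r2 hε hrh rfl hK (fun ξ hξ => ?_) (hW.ray l hl y' hy') ?_ ?_
      (h.rayEnergy_pos (hWO hy) hl') (h.rayEnergy_pos (hWO hy') hl')
    · rw [R.norm_map, R.norm_map]; exact hW.ray l hl y hy ξ hξ
    · rw [h.rayPosition_zero (hWO hy), h.rayPosition_zero (hWO hy'), hR1]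
    · rw [h.rayPosition_one (hWO hy), h.rayPosition_one (hWO hy'), hR2]
  have hs : ∀ l ∈ Ioo 0 l₀,
      HasSum (fun n => l ^ n * (energyCoeff X0 y n - energyCoeff X0 y' n)) 0 := by
    intro l hl
    have := (h.hasSum_energyCoeff hm hrh hsum (hWO hy) (hl1 l hl)).sub
      (h.hasSum_energyCoeff hm hrh hsum (hWO hy') (hl1 l hl))
    rw [hE l hl, sub_self] at this
    simpa only [mul_sub] using this
  have hpos := hW.pos
  have habs : Summable fun n => |energyCoeff X0 y n - energyCoeff X0 y' n| * (l₀ / 2) ^ n := by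
    refine (hs (l₀ / 2) ⟨by linarith, by linarith⟩).summable.abs.congr fun n => ?_
    rw [abs_mul, abs_of_nonneg (by positivity : 0 ≤ (l₀ / 2) ^ n), mul_comm]
  have := coeff_eq_zero_of_tsum_eq_zero (by linarith : 0 < l₀ / 2) habs
    (fun l hl => (hs l ⟨hl.1, by linarith [hl.2]⟩).tsum_eq) n
  linarith

end IsQuasiMinkowskian

/-! ### Derivative of the energy with respect to the angle -/

/-- A function squeezed between its value plus a linear form of the increment of a curve, and the
same plus the square of that increment, is differentiable along the curve. -/
theorem hasDerivAt_of_inner_le_of_le_inner {z : ℝ → Vec3} {z' p : Vec3} {Q : ℝ → ℝ} {ν : ℝ}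
    (hz : HasDerivAt z z' ν) (hlow : ∀ᶠ t in 𝓝 ν, inner ℝ p (z t - z ν) ≤ Q t - Q ν)
    (hup : ∀ᶠ t in 𝓝 ν, Q t - Q ν ≤ inner ℝ p (z t - z ν) + ‖z t - z ν‖ ^ 2) :
    HasDerivAt Q (inner ℝ p z') ν := by
  have hlin : HasDerivAt (fun t => inner ℝ p (z t)) (inner ℝ p z') ν := by
    simpa using (hasDerivAt_const ν p).inner ℝ hz
  have hrem : HasDerivAt (fun t => Q t - inner ℝ p (z t)) 0 ν := by
    rw [hasDerivAt_iff_isLittleO]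
    have h1 : (fun t => z t - z ν) =O[𝓝 ν] fun t => t - ν := hz.isBigO_sub
    have h2 : (fun t => ‖z t - z ν‖ ^ 2) =o[𝓝 ν] fun t => t - ν := by
      have h3 : (fun t => ‖z t - z ν‖ ^ 2) =O[𝓝 ν] fun t => (t - ν) ^ 2 := h1.norm_left.pow 2
      refine h3.trans_isLittleO ?_
      have h4 : Tendsto (fun t => t - ν) (𝓝 ν) (𝓝 0) := by
        have : ContinuousAt (fun t => t - ν) ν := by fun_prop
        simpa using this.tendsto
      exact (Asymptotics.isLittleO_pow_id (n := 2) (by norm_num)).comp_tendsto h4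
    refine Asymptotics.IsBigO.trans_isLittleO (Asymptotics.IsBigO.of_bound 1 ?_) h2
    filter_upwards [hlow, hup] with t a b
    rw [inner_sub_right] at a b
    rw [smul_zero, sub_zero, one_mul, Real.norm_eq_abs, Real.norm_of_nonneg (sq_nonneg _), abs_le]
    have := sq_nonneg ‖z t - z ν‖
    constructor <;> linarith
  have := hrem.add hlin
  rw [zero_add] at this
  exact this.congr_of_eventuallyEq (Eventually.of_forall fun t => by simp)

/-- The coefficients, as a power series in the gravitational constant, of the component along `z'`
of the final momentum of the ray with end points `y`; here `s = m / r_B`. -/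
noncomputable def momentumCoeff (κ : ℕ → ℝ) (X : ℕ → Vec3 → Vec3 → ℝ → Vec3) (s : ℝ)
    (y : Vec3 × Vec3) (z' : Vec3) (n : ℕ) : ℝ :=
  ∑ kl ∈ Finset.HasAntidiagonal.antidiagonal n,
    (potentialCoeff κ kl.1 * s ^ kl.1) * inner ℝ (velocityCoeff X y kl.2) z'

namespace IsQuasiMinkowskian

variable {κ : ℕ → ℝ} {m rh c tA : ℝ} {O : Set (Vec3 × Vec3)}
  {X0 : ℕ → Vec3 → Vec3 → ℝ → ℝ} {X : ℕ → Vec3 → Vec3 → ℝ → Vec3}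
  {W : Set (Vec3 × Vec3)} {S l₀ : ℝ}

theorem hasSum_momentumCoeff (h : IsQuasiMinkowskian κ m rh c tA O X0 X) (hm : 0 < m)
    (hrh : 0 < rh)
    (hsum : ∀ r, rh < r → Summable (fun n : ℕ => κ (n + 1) * (m / r) ^ (n + 1)))
    {y : Vec3 × Vec3} (hy : y ∈ O) {r : ℝ} (hr : rh < r) (z' : Vec3) {l : ℝ}
    (hl : l ∈ Icc (0 : ℝ) 1) :
    HasSum (fun n => l ^ n * momentumCoeff κ X (m / r) y z' n)
      (inner ℝ (potential κ (l * m) r • rayVelocity X y l 1) z') := by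
  have hr0 : 0 < r := hrh.trans hr
  have hl0 := hl.1
  have hs : m / r < m / rh := by gcongr
  have ha : Summable fun n => ‖(potentialCoeff κ n * (m / r) ^ n) * l ^ n‖ := by
    refine Summable.of_nonneg_of_le (fun n => norm_nonneg _) (fun n => ?_)
      (summable_potentialCoeff hm hrh hsum (by positivity : 0 ≤ m / r) hs)
    rw [norm_mul, norm_mul, norm_pow, norm_pow, Real.norm_of_nonneg (by positivity : 0 ≤ m / r),
      Real.norm_of_nonneg hl0]
    exact mul_le_of_le_one_right (by positivity) (pow_le_one₀ hl0 hl.2)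
  have hv := h.hasSum_velocityCoeff hy hl
  have hb : HasSum (fun n => inner ℝ (velocityCoeff X y n) z' * l ^ n)
      (inner ℝ (rayVelocity X y l 1) z') := by
    have h1 := hv.mapL (innerSL ℝ z')
    simp only [innerSL_apply_apply, real_inner_smul_right] at h1
    rw [real_inner_comm]
    refine h1.congr_fun ?_
    intro n
    rw [real_inner_comm, mul_comm]
  have hprod := hasSum_cauchyProduct ha hb.summable.norm
  rw [hb.tsum_eq] at hprod
  have hpot : ∑' n, (potentialCoeff κ n * (m / r) ^ n) * l ^ n = potential κ (l * m) r := by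
    have e : ∀ n, (potentialCoeff κ n * (m / r) ^ n) * l ^ n =
        potentialCoeff κ n * (l * m / r) ^ n := by
      intro n
      rw [mul_assoc, ← mul_pow]; congr 2; ring
    rw [tsum_congr e, potential_eq, potentialSeries_eq (ha.congr fun n => by rw [e])]
  rw [hpot] at hprod
  rw [real_inner_smul_left]
  simpa only [momentumCoeff, mul_comm] using hprod

/-- The derivative of the half square of the energy with respect to the final end point is the
final momentum. -/
theorem hasDerivAt_rayEnergy_sq (h : IsQuasiMinkowskian κ m rh c tA O X0 X) (hm : 0 < m)
    (hrh : 0 < rh)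
    (hsum : ∀ r, rh < r → Summable (fun n : ℕ => κ (n + 1) * (m / r) ^ (n + 1)))
    (hWO : W ⊆ O) (hW : IsConvexityRegion κ m rh X W S l₀) {l : ℝ} (hl : l ∈ Ioo 0 l₀)
    {a : Vec3} {z : ℝ → Vec3} {z' : Vec3} {ν : ℝ} (hz : HasDerivAt z z' ν)
    (hzW : ∀ᶠ t in 𝓝 ν, (a, z t) ∈ W) :
    HasDerivAt (fun t => 1 / 2 * rayEnergy X0 (a, z t) l ^ 2)
      (inner ℝ (potential κ (l * m) ‖z ν‖ • rayVelocity X (a, z ν) l 1) z') ν := by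
  have hl' : l ∈ Icc (0 : ℝ) 1 := ⟨hl.1.le, hl.2.le.trans hW.le_one⟩
  obtain ⟨ε, hε, hK⟩ := hW.nearlyFlat l hl
  have hν : (a, z ν) ∈ W := hzW.self_of_nhds
  have r1 := (h.isOpticalRay_and_time hm hrh hsum (hWO hν) hl').1
  have e1 := h.rayPosition_one (hWO hν) l
  refine hasDerivAt_of_inner_le_of_le_inner hz ?_ ?_
  · filter_upwards [hzW] with t ht
    have r2 := (h.isOpticalRay_and_time hm hrh hsum (hWO ht) hl').1
    have := r1.inner_momentum_le r2 hε hrh rfl hK (hW.ray l hl _ hν) (hW.ray l hl _ ht)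
      (by rw [h.rayPosition_zero (hWO hν), h.rayPosition_zero (hWO ht)])
    rwa [e1, h.rayPosition_one (hWO ht) l] at this
  · filter_upwards [hzW] with t ht
    have r2 := (h.isOpticalRay_and_time hm hrh hsum (hWO ht) hl').1
    have := r1.le_inner_momentum r2 hε hrh rfl hK (hW.ray l hl _ hν) (hW.ray l hl _ ht)
      (by rw [e1, h.rayPosition_one (hWO ht) l]; exact hW.tilted l hl _ hν _ ht rfl)
      (by rw [h.rayPosition_zero (hWO hν), h.rayPosition_zero (hWO ht)])
    rwa [e1, h.rayPosition_one (hWO ht) l] at this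

/-- The coefficients of the energy are differentiable in the cosine of the angle; the series of
their derivatives converges absolutely for `l ≤ 1` and its sum is the derivative of the energy,
that is, the component of the final momentum along the variation of the end point, divided by the
energy. -/
theorem exists_hasDerivAt_energyCoeff (h : IsQuasiMinkowskian κ m rh c tA O X0 X) (hm : 0 < m)
    (hrh : 0 < rh)
    (hsum : ∀ r, rh < r → Summable (fun n : ℕ => κ (n + 1) * (m / r) ^ (n + 1)))
    (hWO : W ⊆ O) (hW : IsConvexityRegion κ m rh X W S l₀) {xA xB : Vec3}
    (hWn : W ∈ 𝓝 (xA, xB)) (hne : xA ≠ xB) (hB : rh < ‖xB‖) (hA0 : xA ≠ 0)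
    (hμ : cosAngle xA xB ∈ Ioo (-1 : ℝ) 1) :
    ∃ E' : ℕ → ℝ,
      (∀ n, HasDerivAt (fun ν => energyCoeff X0 (xA, rotatedPoint xA xB ν) n) (E' n)
        (cosAngle xA xB)) ∧
      (Summable fun n => |E' n|) ∧
      (Summable fun n =>
        |momentumCoeff κ X (m / ‖xB‖) (xA, xB) (rotatedPointDeriv xA xB (cosAngle xA xB)) n|) ∧
      ∀ l ∈ Icc (0 : ℝ) 1, rayEnergy X0 (xA, xB) l * ∑' n, l ^ n * E' n =
        inner ℝ (potential κ (l * m) ‖xB‖ • rayVelocity X (xA, xB) l 1)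
          (rotatedPointDeriv xA xB (cosAngle xA xB)) := by
  have hB0 : xB ≠ 0 := norm_pos_iff.mp (hrh.trans hB)
  set μ := cosAngle xA xB with hμdef
  set z := rotatedPoint xA xB
  set z' := rotatedPointDeriv xA xB
  have hzμ : z μ = xB := rotatedPoint_cosAngle hB0 hμ
  -- an interval of cosines on which all bounds are uniform
  set D := ‖z' μ‖ + 1 with hD
  have hev : ∀ᶠ ν in 𝓝 μ, (xA, z ν) ∈ W ∧ ν ∈ Ioo (-1 : ℝ) 1 ∧ ‖z' ν‖ < D := by
    have h1 : ContinuousAt (fun ν => (xA, z ν)) μ :=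
      continuousAt_const.prodMk (hasDerivAt_rotatedPoint hμ).continuousAt
    have h2 : W ∈ 𝓝 (xA, z μ) := by rw [hzμ]; exact hWn
    have h3 : ∀ᶠ ν in 𝓝 μ, ‖z' ν‖ < D :=
      (continuousAt_rotatedPointDeriv hμ).norm.eventually_lt continuousAt_const (by simp [hD, z'])
    filter_upwards [h1.eventually h2, isOpen_Ioo.mem_nhds hμ, h3] with ν a b d
    exact ⟨a, b, d⟩
  obtain ⟨r, hr, hball⟩ := Metric.eventually_nhds_iff_ball.mp hev
  set N := Metric.ball μ r with hN
  have hNo : IsOpen N := Metric.isOpen_ball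
  have hμN : μ ∈ N := Metric.mem_ball_self hr
  have hzN : ∀ ν ∈ N, ‖z ν‖ = ‖xB‖ := fun ν hν =>
    norm_rotatedPoint hA0 hB0 hμ (hball ν hν).2.1
  -- `ρ` is less than the radii of convergence of the ray and of the potential at `r_B`
  obtain ⟨R, hR, M, hM0, hM, hb⟩ := h.exists_bound ⟨_, mem_of_mem_nhds (mem_of_superset hWn hWO)⟩
  have hrat : 1 < ‖xB‖ / rh := by rwa [one_lt_div hrh]
  obtain ⟨ρ, hρ1, hρ2⟩ := exists_between (lt_min hR hrat)
  have hρR : ρ < R := hρ2.trans_le (min_le_left _ _)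
  have hρB : ρ < ‖xB‖ / rh := hρ2.trans_le (min_le_right _ _)
  have hρ0 : 0 < ρ := by linarith
  have hB1 : 0 < ‖xB‖ := hrh.trans hB
  set BE : ℕ → ℝ := fun n => if n = 0 then S else M n with hBE
  have hS0 : 0 ≤ S := (norm_nonneg _).trans (hW.norm_sub_le _ (mem_of_mem_nhds hWn))
  have hBE0 : ∀ n, 0 ≤ BE n := by
    intro n
    rcases Nat.eq_zero_or_pos n with rfl | hn
    · simpa [hBE] using hS0
    · simp only [hBE, if_neg hn.ne']; exact hM0 n hn
  have hBEs : Summable fun n => ‖BE n * ρ ^ n‖ := by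
    rw [← summable_nat_add_iff 1]
    refine Summable.of_nonneg_of_le (fun n => norm_nonneg _) (fun n => ?_)
      ((summable_nat_add_iff (f := fun n => M n * R ^ n) 1).mpr hM)
    have h0 := hM0 (n + 1) (by omega)
    simp only [hBE, if_neg (Nat.succ_ne_zero n)]
    rw [Real.norm_of_nonneg (by positivity)]
    gcongr
  set E : ℕ → ℝ → ℝ := fun n ν => energyCoeff X0 (xA, z ν) n with hEdef
  have hEb : ∀ n, ∀ ν ∈ N, |E n ν| ≤ BE n := by
    intro n ν hν
    rcases Nat.eq_zero_or_pos n with rfl | hn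
    · simpa [hBE, hEdef, energyCoeff] using hW.norm_sub_le _ (hball ν hν).1
    · simp only [hEdef, hBE, energyCoeff, if_neg hn.ne']
      exact (hb n hn _ (hWO (hball ν hν).1) 1 (by simp)).1
  have hVb : ∀ n, ∀ ν ∈ N, ‖velocityCoeff X (xA, z ν) n‖ ≤ BE n := by
    intro n ν hν
    rcases Nat.eq_zero_or_pos n with rfl | hn
    · simpa [hBE, velocityCoeff] using hW.norm_sub_le _ (hball ν hν).1
    · simp only [hBE, velocityCoeff, if_neg hn.ne']
      exact (hb n hn _ (hWO (hball ν hν).1) 1 (by simp)).2.2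
  set A : ℕ → ℝ := fun n => |potentialCoeff κ n * (m / ‖xB‖) ^ n| with hA
  have hAs : Summable fun n => ‖A n * ρ ^ n‖ := by
    refine (summable_potentialCoeff hm hrh hsum (s := m / ‖xB‖ * ρ) (by positivity) ?_).congr
      fun n => ?_
    · rw [lt_div_iff₀ hrh] at hρB ⊢
      calc m / ‖xB‖ * ρ * rh = m / ‖xB‖ * (ρ * rh) := by ring
        _ < m / ‖xB‖ * ‖xB‖ := by gcongr
        _ = m := by field_simp
    · simp only [hA]
      rw [norm_mul, Real.norm_eq_abs |_|, abs_abs, abs_mul, norm_pow,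
        Real.norm_of_nonneg hρ0.le, abs_pow, abs_of_nonneg (by positivity : 0 ≤ m / ‖xB‖), mul_pow,
        Real.norm_eq_abs]
      ring
  set G : ℕ → ℝ := fun n => 2 * ∑ kl ∈ Finset.HasAntidiagonal.antidiagonal n,
    A kl.1 * (BE kl.2 * D) with hG
  set g : ℕ → ℝ → ℝ := fun n ν => momentumCoeff κ X (m / ‖xB‖) (xA, z ν) (z' ν) n with hgdef
  have hD0 : 0 ≤ D := by positivity
  have hgb : ∀ n, ∀ ν ∈ N, |2 * g n ν| ≤ G n := by
    intro n ν hν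
    rw [abs_mul, abs_two]
    refine mul_le_mul_of_nonneg_left ?_ zero_le_two
    refine (Finset.abs_sum_le_sum_abs _ _).trans (Finset.sum_le_sum fun kl _ => ?_)
    rw [abs_mul]
    refine mul_le_mul_of_nonneg_left ?_ (abs_nonneg _)
    refine (abs_real_inner_le_norm _ _).trans ?_
    exact mul_le_mul (hVb _ ν hν) (hball ν hν).2.2.le (norm_nonneg _) (hBE0 _)
  have hGs : Summable fun n => G n * ρ ^ n := by
    have hBEs' : Summable fun n => ‖(BE n * D) * ρ ^ n‖ := by
      refine (hBEs.mul_right ‖D‖).congr fun n => ?_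
      rw [← norm_mul]; congr 1; ring
    refine ((hasSum_cauchyProduct hAs hBEs').summable.mul_left 2).congr fun n => ?_
    simp only [hG]; ring
  set F : ℕ → ℝ → ℝ := fun n ν =>
    ∑ kl ∈ Finset.HasAntidiagonal.antidiagonal n, E kl.1 ν * E kl.2 ν with hFdef
  set BF : ℕ → ℝ := fun n =>
    ∑ kl ∈ Finset.HasAntidiagonal.antidiagonal n, BE kl.1 * BE kl.2 with hBF
  have hBFs : Summable fun n => BF n * ρ ^ n := (hasSum_cauchyProduct hBEs hBEs).summable
  have hFb : ∀ n, ∀ ν ∈ N, |F n ν| ≤ BF n := by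
    intro n ν hν
    refine (Finset.abs_sum_le_sum_abs _ _).trans (Finset.sum_le_sum fun kl _ => ?_)
    rw [abs_mul]
    exact mul_le_mul (hEb _ ν hν) (hEb _ ν hν) (abs_nonneg _) (hBE0 _)
  have hF0 : ∀ n, 0 ≤ BF n := fun n => (abs_nonneg _).trans (hFb n μ hμN)
  have hG0 : ∀ n, 0 ≤ G n := fun n => (abs_nonneg _).trans (hgb n μ hμN)
  have hl1 : ∀ l ∈ Ioo 0 l₀, l ∈ Icc (0 : ℝ) 1 := fun l hl =>
    ⟨hl.1.le, hl.2.le.trans hW.le_one⟩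
  have hsumE : ∀ ν ∈ N, ∀ l ∈ Icc (0 : ℝ) 1, HasSum (fun n => E n ν * l ^ n)
      (rayEnergy X0 (xA, z ν) l) := by
    intro ν hν l hl
    simpa only [mul_comm] using h.hasSum_energyCoeff hm hrh hsum (hWO (hball ν hν).1) hl
  have hsumF : ∀ ν ∈ N, ∀ l ∈ Icc (0 : ℝ) 1, HasSum (fun n => l ^ n * F n ν)
      (rayEnergy X0 (xA, z ν) l ^ 2) := by
    intro ν hν l hl
    have h1 := (hsumE ν hν l hl)
    have h2 := hasSum_cauchyProduct h1.summable.norm h1.summable.norm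
    rw [h1.tsum_eq, ← sq] at h2
    simpa only [hFdef, mul_comm] using h2
  have hsumg : ∀ ν ∈ N, ∀ l ∈ Icc (0 : ℝ) 1, HasSum (fun n => l ^ n * g n ν)
      (inner ℝ (potential κ (l * m) ‖xB‖ • rayVelocity X (xA, z ν) l 1) (z' ν)) :=
    fun ν hν l hl => h.hasSum_momentumCoeff hm hrh hsum (hWO (hball ν hν).1) hB (z' ν) hl
  -- the coefficients of the square of the energy
  have hFder : ∀ n, ∀ ν ∈ N, HasDerivAt (F n) (2 * g n ν) ν := by
    have hs : Summable fun n => (BF n + G n) * l₀ ^ n := by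
      refine Summable.of_nonneg_of_le (fun n => ?_) (fun n => ?_) (hBFs.add hGs)
      · have := hF0 n; have := hG0 n; have := hW.pos; positivity
      · rw [← add_mul]
        have := hF0 n; have := hG0 n; have := hW.pos
        have : l₀ ≤ ρ := hW.le_one.trans hρ1.le
        gcongr
    refine hasDerivAt_coeff (g := fun n ν => 2 * g n ν) hW.pos hs hNo
      (fun n ν hν => (hFb n ν hν).trans (le_add_of_nonneg_right (hG0 n)))
      (fun n ν hν => (hgb n ν hν).trans (le_add_of_nonneg_left (hF0 n))) ?_
    intro l hl ν hν
    have h1 := (h.hasDerivAt_rayEnergy_sq hm hrh hsum hWO hW hl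
      (hasDerivAt_rotatedPoint (xA := xA) (xB := xB) (hball ν hν).2.1)
      (by filter_upwards [hNo.mem_nhds hν] with t ht using (hball t ht).1)).const_mul 2
    rw [norm_rotatedPoint hA0 hB0 hμ (hball ν hν).2.1] at h1
    have h2 : ∑' n, l ^ n * (2 * g n ν) =
        2 * inner ℝ (potential κ (l * m) ‖xB‖ • rayVelocity X (xA, z ν) l 1) (z' ν) := by
      rw [← (hsumg ν hν l (hl1 l hl)).tsum_eq, ← tsum_mul_left]
      exact tsum_congr fun n => by ring
    rw [h2]
    refine h1.congr_of_eventuallyEq ?_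
    filter_upwards [hNo.mem_nhds hν] with t ht
    rw [(hsumF t ht l (hl1 l hl)).tsum_eq]
    ring
  have hE0 : E 0 μ ≠ 0 := by
    simp only [hEdef, energyCoeff, if_true, hzμ]
    exact (norm_pos_iff.mpr (sub_ne_zero.mpr hne.symm)).ne'
  have hE0d : DifferentiableAt ℝ (E 0) μ := by
    simp only [hEdef, energyCoeff, if_true]
    refine DifferentiableAt.norm ℝ
      ((hasDerivAt_rotatedPoint hμ).differentiableAt.sub (differentiableAt_const xA)) ?_
    change z μ - xA ≠ 0
    rw [hzμ]; exact sub_ne_zero.mpr hne.symm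
  have hEd : ∀ n, HasDerivAt (E n) (deriv (E n) μ) μ := fun n =>
    (differentiableAt_of_sq hE0d hE0 (fun n => (hFder n μ hμN).differentiableAt) n).hasDerivAt
  have hE's : Summable fun n => |deriv (E n) μ| := by
    refine summable_deriv_of_sq (B := BE) (G := G) hρ1 hBEs.of_norm hGs (hNo.mem_nhds hμN)
      hEb hE0 hEd fun n ν hν => ?_
    exact (convex_ball μ r).norm_image_sub_le_of_norm_hasDerivWithin_le
      (fun ν hν => (hFder n ν hν).hasDerivWithinAt) (fun ν hν => hgb n ν hν) hμN hν
  have hzE : ∀ l, rayEnergy X0 (xA, z μ) l = rayEnergy X0 (xA, xB) l := fun l => by rw [hzμ]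
  have hgμ : ∀ n, momentumCoeff κ X (m / ‖xB‖) (xA, xB) (z' μ) n = g n μ := by
    intro n; simp only [hgdef]; rw [hzμ]
  refine ⟨fun n => deriv (E n) μ, hEd, hE's, ?_, fun l hl => ?_⟩
  · simp only [hgμ]
    refine Summable.of_nonneg_of_le (fun n => abs_nonneg _) (fun n => ?_) hGs
    have h1 := hgb n μ hμN
    rw [abs_mul, abs_two] at h1
    have h2 : G n ≤ G n * ρ ^ n := le_mul_of_one_le_right (hG0 n) (one_le_pow₀ hρ1.le)
    linarith [abs_nonneg (g n μ)]
  · have h1 := hsumE μ hμN l hl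
    have h2 : Summable fun n => ‖deriv (E n) μ * l ^ n‖ := by
      refine Summable.of_nonneg_of_le (fun n => norm_nonneg _) (fun n => ?_) hE's
      rw [norm_mul, norm_pow, Real.norm_of_nonneg hl.1]
      exact mul_le_of_le_one_right (norm_nonneg _) (pow_le_one₀ hl.1 hl.2)
    have h3 := hasSum_cauchyProduct h1.summable.norm h2
    have h4 := hsumg μ hμN l hl
    rw [h1.tsum_eq, hzE] at h3
    have h5 : ∀ n, ∑ kl ∈ Finset.HasAntidiagonal.antidiagonal n, E kl.1 μ * deriv (E kl.2) μ =
        g n μ := fun n => sum_antidiagonal_mul_deriv hEd (hFder n μ hμN)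
    simp only [h5] at h3
    rw [hzμ] at h4
    have h6 : ∑' n, l ^ n * deriv (E n) μ = ∑' n, deriv (E n) μ * l ^ n :=
      tsum_congr fun n => mul_comm _ _
    rw [h6]
    refine h3.unique ?_
    simpa only [mul_comm] using h4

end IsQuasiMinkowskian

/-! ### The impact parameter -/

namespace IsOpticalRay

variable {U : ℝ → ℝ} {E : ℝ} {x v : ℝ → Vec3}

theorem norm_cross_mul_eq (h : IsOpticalRay U E x v) (hE : E ≠ 0) {ξ : ℝ}
    (hξ : ξ ∈ Icc (0 : ℝ) 1) :
    U ‖x ξ‖ * ‖cross (x ξ) (v ξ)‖ = ‖cross (x 1) (U ‖x 1‖ • v 1)‖ := by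
  have hU : 0 ≤ U ‖x ξ‖ := by
    by_contra! hneg
    have h1 := h.null ξ hξ
    have h2 : 0 < E ^ 2 := by positivity
    nlinarith [sq_nonneg ‖v ξ‖]
  rw [h.cross_momentum_eq 1 (by simp), ← h.cross_momentum_eq ξ hξ, cross_smul_right, norm_smul,
    Real.norm_of_nonneg hU]

/-- The angular momentum is normal to the plane of the end points. -/
theorem norm_cross_mul_norm_eq_abs (h : IsOpticalRay U E x v) :
    ‖cross (x 0) (x 1)‖ * ‖cross (x 1) (U ‖x 1‖ • v 1)‖ =
      |inner ℝ (cross (x 0) (x 1)) (cross (x 1) (U ‖x 1‖ • v 1))| := by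
  refine norm_mul_norm_eq_abs_inner_cross ?_ (inner_cross_self_left _ _)
  rw [h.cross_momentum_eq 1 (by simp)]
  exact inner_cross_self_left _ _

end IsOpticalRay

namespace IsQuasiMinkowskian

variable {κ : ℕ → ℝ} {m rh c tA : ℝ} {O : Set (Vec3 × Vec3)}
  {X0 : ℕ → Vec3 → Vec3 → ℝ → ℝ} {X : ℕ → Vec3 → Vec3 → ℝ → Vec3}

theorem impactParameter_eq (h : IsQuasiMinkowskian κ m rh c tA O X0 X) (hm : 0 < m)
    (hrh : 0 < rh)
    (hsum : ∀ r, rh < r → Summable (fun n : ℕ => κ (n + 1) * (m / r) ^ (n + 1)))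
    {y : Vec3 × Vec3} (hy : y ∈ O) {l : ℝ} (hl : l ∈ Icc (0 : ℝ) 1) {ξ : ℝ}
    (hξ : ξ ∈ Icc (0 : ℝ) 1) :
    impactParameter (potential κ (l * m))
      (rayPath c tA y.1 y.2 (fun n => X0 n y.1 y.2) (fun n => X n y.1 y.2) l ξ)
      (rayTangent y.1 y.2 (fun n => X0 n y.1 y.2) (fun n => X n y.1 y.2) l ξ) =
    ‖cross y.2 (potential κ (l * m) ‖y.2‖ • rayVelocity X y l 1)‖ / rayEnergy X0 y l := by
  obtain ⟨h1, h2, -⟩ := h.isOpticalRay_and_time hm hrh hsum hy hl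
  have h3 := h1.norm_cross_mul_eq (h.rayEnergy_pos hy hl).ne' hξ
  rw [h.rayPosition_one hy] at h3
  rw [impactParameter, energy, opticalMetric, h2 ξ hξ, inner_zero_right, mul_zero, sub_zero,
    mul_one, ← h3]
  rfl

/-- The component of the angular momentum along the normal `𝐱_A × 𝐱_B` keeps, for all values of the
gravitational constant, the sign it has for the straight line, since it depends continuously on
this constant and a ray without angular momentum is radial. -/
theorem inner_cross_pos (h : IsQuasiMinkowskian κ m rh c tA O X0 X) (hm : 0 < m) (hrh : 0 < rh)
    (hsum : ∀ r, rh < r → Summable (fun n : ℕ => κ (n + 1) * (m / r) ^ (n + 1)))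
    {xA xB : Vec3} (hy : (xA, xB) ∈ O) (hdir : direction xA ≠ direction xB) (hB : rh < ‖xB‖)
    (hA0 : xA ≠ 0) (hμ : cosAngle xA xB ∈ Ioo (-1 : ℝ) 1)
    (hs : Summable fun n =>
      |momentumCoeff κ X (m / ‖xB‖) (xA, xB) (rotatedPointDeriv xA xB (cosAngle xA xB)) n|)
    {l : ℝ} (hl : l ∈ Icc (0 : ℝ) 1) :
    0 < inner ℝ (cross xA xB)
      (cross xB (potential κ (l * m) ‖xB‖ • rayVelocity X (xA, xB) l 1)) := by
  have hB0 : xB ≠ 0 := norm_pos_iff.mp (hrh.trans hB)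
  set f : ℝ → ℝ := fun l => inner ℝ (cross xA xB)
      (cross xB (potential κ (l * m) ‖xB‖ • rayVelocity X (xA, xB) l 1)) with hf
  have hcr : 0 < ‖cross xA xB‖ := norm_cross_pos hA0 hB0 hμ
  have hcont : ContinuousOn f (Icc 0 1) := by
    have hc : ContinuousOn (fun l : ℝ => ∑' n, l ^ n * momentumCoeff κ X (m / ‖xB‖) (xA, xB)
        (rotatedPointDeriv xA xB (cosAngle xA xB)) n) (Icc 0 1) := by
      refine continuousOn_tsum (fun n => by fun_prop) hs fun n l hl => ?_
      rw [norm_mul, norm_pow, Real.norm_of_nonneg hl.1]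
      exact mul_le_of_le_one_left (norm_nonneg _) (pow_le_one₀ hl.1 hl.2)
    refine (hc.const_mul (-(‖cross xA xB‖ * √(1 - cosAngle xA xB ^ 2)))).congr fun l hl => ?_
    have h1 := inner_rotatedPointDeriv hA0 hB0 hμ
      (potential κ (l * m) ‖xB‖ • rayVelocity X (xA, xB) l 1)
    simp only
    rw [(h.hasSum_momentumCoeff hm hrh hsum hy hB _ hl).tsum_eq, neg_mul, mul_assoc, h1]
    simp only [hf]
    field_simp
  have hne : ∀ l ∈ Icc (0 : ℝ) 1, f l ≠ 0 := by
    intro l hl h0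
    obtain ⟨h1, -, -⟩ := h.isOpticalRay_and_time hm hrh hsum hy hl
    have h2 := h1.norm_cross_mul_norm_eq_abs
    rw [h.rayPosition_zero hy, h.rayPosition_one hy] at h2
    simp only [hf] at h0
    rw [h0, abs_zero] at h2
    have h3 := norm_eq_zero.mp ((mul_eq_zero.mp h2).resolve_left hcr.ne')
    have h4 := h1.direction_eq_of_cross_eq_zero (h.rayEnergy_pos hy hl).ne'
      (h.rayPosition_ne_zero hrh hy hl) (by rw [h.rayPosition_one hy]; exact h3)
    rw [h.rayPosition_zero hy, h.rayPosition_one hy] at h4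
    exact hdir h4
  have hzero : 0 < f 0 := by
    have h1 : potential κ (0 * m) ‖xB‖ = 1 := by simp [potential]
    have h2 : rayVelocity X (xA, xB) 0 1 = xB - xA := by simp [rayVelocity]
    simp only [hf]
    rw [h1, h2, one_smul, cross_sub_self, real_inner_self_eq_norm_sq]
    positivity
  by_contra! hle
  obtain ⟨t, ht, ht0⟩ := intermediate_value_Icc' hl.1
    (hcont.mono (Icc_subset_Icc le_rfl hl.2)) ⟨hle, hzero.le⟩
  exact hne t ⟨ht.1, ht.2.trans hl.2⟩ ht0

end IsQuasiMinkowskian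

theorem proposition3 (κ : ℕ → ℝ) (m rh c tA : ℝ) (hm : 0 < m) (hrh : 0 < rh) (hc : 0 < c)
    (hsum : ∀ r, rh < r → Summable (fun n : ℕ => κ (n + 1) * (m / r) ^ (n + 1)))
    (hpos : ∀ r, rh < r → 0 < potential κ m r)
    (xA xB : Vec3)
    (hdir : direction xA ≠ direction xB)
    (hseg : ∀ ξ ∈ Set.Icc (0 : ℝ) 1, rh < ‖segmentPoint xA xB ξ‖)
    (O : Set (Vec3 × Vec3)) (hO : O ∈ nhds (xA, xB))
    (X0 : ℕ → Vec3 → Vec3 → ℝ → ℝ) (X : ℕ → Vec3 → Vec3 → ℝ → Vec3)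
    (hray : IsQuasiMinkowskian κ m rh c tA O X0 X) :
    lineDist xA xB =
      ‖xA‖ * ‖xB‖ / ‖xB - xA‖ * ‖cross (direction xA) (direction xB)‖ ∧
    0 < lineDist xA xB ∧
    ∃ T : ℕ → ℝ → ℝ → ℝ → ℝ,
      (∀ᶠ y in nhds (xA, xB), ∀ n ≥ 1,
        timeTerm c X0 n y.1 y.2 = T n ‖y.1‖ ‖y.2‖ (cosAngle y.1 y.2)) ∧
      (∀ n ≥ 1, DifferentiableAt ℝ (fun ν => T n ‖xA‖ ‖xB‖ ν) (cosAngle xA xB)) ∧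
      ∀ lam ∈ Set.Icc (0 : ℝ) 1, ∀ ξ ∈ Set.Icc (0 : ℝ) 1,
        Summable (fun n : ℕ => (lam * m / lineDist xA xB) ^ (n + 1) *
          impactCoeff c m (lineDist xA xB) T ‖xA‖ ‖xB‖ (cosAngle xA xB) (n + 1)) ∧
        impactParameter (potential κ (lam * m))
            (rayPath c tA xA xB (fun n => X0 n xA xB) (fun n => X n xA xB) lam ξ)
            (rayTangent xA xB (fun n => X0 n xA xB) (fun n => X n xA xB) lam ξ) =
          lineDist xA xB * (1 + ∑' n : ℕ, (lam * m / lineDist xA xB) ^ (n + 1) *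
            impactCoeff c m (lineDist xA xB) T ‖xA‖ ‖xB‖ (cosAngle xA xB) (n + 1)) := by
  have hne : xA ≠ xB := fun h => hdir (by rw [h])
  have hA : rh < ‖xA‖ := by simpa [segmentPoint] using hseg 0 (by simp)
  have hB : rh < ‖xB‖ := by simpa [segmentPoint] using hseg 1 (by simp)
  have hA0 : xA ≠ 0 := norm_pos_iff.mp (hrh.trans hA)
  have hB0 : xB ≠ 0 := norm_pos_iff.mp (hrh.trans hB)
  have hμ : cosAngle xA xB ∈ Ioo (-1 : ℝ) 1 :=
    cosAngle_mem_Ioo hdir fun ξ hξ => norm_pos_iff.mp (hrh.trans (hseg ξ hξ))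
  have hy : (xA, xB) ∈ O := mem_of_mem_nhds hO
  obtain ⟨W, hWn, hWO, S, l₀, hW⟩ := hray.exists_isConvexityRegion hm hrh hsum hO hseg
  obtain ⟨E', hE', hE's, hgs, hident⟩ := hray.exists_hasDerivAt_energyCoeff hm hrh hsum hWO hW hWn
    hne hB hA0 hμ
  set μ := cosAngle xA xB with hμdef
  set b : ℝ → ℝ := fun l =>
    ‖cross xB (potential κ (l * m) ‖xB‖ • rayVelocity X (xA, xB) l 1)‖ / rayEnergy X0 (xA, xB) l
    with hb
  -- the impact parameter is the sum of the series of derivatives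
  have hbsum : ∀ l ∈ Icc (0 : ℝ) 1, b l = -√(1 - μ ^ 2) * ∑' n, l ^ n * E' n := by
    intro l hl
    have hEpos := hray.rayEnergy_pos hy hl
    have h1 := hray.inner_cross_pos hm hrh hsum hy hdir hB hA0 hμ hgs hl
    have h2 := (hray.isOpticalRay_and_time hm hrh hsum hy hl).1.norm_cross_mul_norm_eq_abs
    rw [hray.rayPosition_zero hy, hray.rayPosition_one hy, abs_of_pos h1] at h2
    have h3 := inner_rotatedPointDeriv hA0 hB0 hμ
      (potential κ (l * m) ‖xB‖ • rayVelocity X (xA, xB) l 1)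
    rw [← h2, ← hident l hl, mul_div_cancel_left₀ _ (norm_cross_pos hA0 hB0 hμ).ne'] at h3
    simp only [hb]
    rw [div_eq_iff hEpos.ne']
    linarith
  have hrc : lineDist xA xB = -√(1 - μ ^ 2) * E' 0 := by
    have h0 := hbsum 0 (by simp)
    have h1 : ∑' n, (0 : ℝ) ^ n * E' n = E' 0 := by
      rw [tsum_eq_single 0]
      · simp
      · intro n hn; simp [hn]
    rw [h1] at h0
    rw [← h0, lineDist_eq hne]
    have h2 : potential κ (0 * m) ‖xB‖ = 1 := by simp [potential]
    have h3 : rayVelocity X (xA, xB) 0 1 = xB - xA := by simp [rayVelocity]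
    simp only [hb]
    rw [h2, h3, one_smul, cross_sub_self]
    simp [rayEnergy]
  have hlpos : 0 < lineDist xA xB := by
    rw [lineDist_eq hne]
    have h1 : 0 < ‖xB - xA‖ := norm_pos_iff.mpr (sub_ne_zero.mpr hne.symm)
    have h2 := norm_cross_pos hA0 hB0 hμ
    positivity
  refine ⟨?_, hlpos, ?_⟩
  · rw [lineDist_eq hne, ← norm_cross_direction xA xB hA0 hB0]
    ring
  classical
  -- any choice of end points in `W` with these invariants gives the same value; outside it is `0`
  set T : ℕ → ℝ → ℝ → ℝ → ℝ := fun n rA rB ν =>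
    if hex : ∃ y ∈ W, ‖y.1‖ = rA ∧ ‖y.2‖ = rB ∧ cosAngle y.1 y.2 = ν then
      timeTerm c X0 n hex.choose.1 hex.choose.2 else 0 with hT
  have hTW : ∀ y ∈ W, ∀ n ≥ 1,
      timeTerm c X0 n y.1 y.2 = T n ‖y.1‖ ‖y.2‖ (cosAngle y.1 y.2) := by
    intro y hyW n hn
    have hex : ∃ y' ∈ W, ‖y'.1‖ = ‖y.1‖ ∧ ‖y'.2‖ = ‖y.2‖ ∧
      cosAngle y'.1 y'.2 = cosAngle y.1 y.2 := ⟨y, hyW, rfl, rfl, rfl⟩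
    obtain ⟨h1, h2, h3, h4⟩ := hex.choose_spec
    have h5 := hray.energyCoeff_eq hm hrh hsum hWO hW hyW h1 h2.symm h3.symm h4.symm n
    simp only [energyCoeff, if_neg (by omega : n ≠ 0)] at h5
    simp only [hT]
    rw [dif_pos hex, timeTerm, timeTerm, h5]
  -- near the given angle, `T` is the term of the rays that end at the rotated points
  have hTder : ∀ n ≥ 1, HasDerivAt (fun ν => T n ‖xA‖ ‖xB‖ ν) (E' n / c) μ := by
    intro n hn
    refine ((hE' n).div_const c).congr_of_eventuallyEq ?_
    have h1 : ContinuousAt (fun ν => (xA, rotatedPoint xA xB ν)) μ :=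
      continuousAt_const.prodMk (hasDerivAt_rotatedPoint hμ).continuousAt
    have h2 : W ∈ 𝓝 (xA, rotatedPoint xA xB μ) := by rw [rotatedPoint_cosAngle hB0 hμ]; exact hWn
    filter_upwards [h1.eventually h2, isOpen_Ioo.mem_nhds hμ] with ν hν hν1
    have h3 := hTW _ hν n hn
    simp only [norm_rotatedPoint hA0 hB0 hμ hν1, cosAngle_rotatedPoint hA0 hB0 hμ hν1] at h3
    rw [← h3, timeTerm, energyCoeff, if_neg (by omega)]
  refine ⟨T, ?_, fun n hn => (hTder n hn).differentiableAt, ?_⟩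
  · filter_upwards [hWn] with y hyW n hn using hTW y hyW n hn
  intro l hl ξ hξ
  have hq : ∀ n : ℕ, (l * m / lineDist xA xB) ^ (n + 1) *
      impactCoeff c m (lineDist xA xB) T ‖xA‖ ‖xB‖ μ (n + 1) =
      -√(1 - μ ^ 2) / lineDist xA xB * (l ^ (n + 1) * E' (n + 1)) := by
    intro n
    rw [impactCoeff, (hTder (n + 1) (by omega)).deriv, div_pow, div_pow, mul_pow]
    field_simp
  have hs : Summable fun n => l ^ n * E' n := by
    refine Summable.of_norm_bounded hE's fun n => ?_
    rw [norm_mul, norm_pow, Real.norm_of_nonneg hl.1]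
    exact mul_le_of_le_one_left (norm_nonneg _) (pow_le_one₀ hl.1 hl.2)
  simp only [hq]
  refine ⟨((summable_nat_add_iff (f := fun n => l ^ n * E' n) 1).mpr hs).mul_left _, ?_⟩
  refine (hray.impactParameter_eq hm hrh hsum hy hl hξ).trans ((hbsum l hl).trans ?_)
  rw [tsum_mul_left, hs.tsum_eq_zero_add, pow_zero, one_mul, mul_add, mul_add, mul_one, ← hrc]
  congr 1
  field_simp
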